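/- Let $\Omega\subseteq\mathbb{R}^d$ be open. A scalar weight on $\Omega$ is a measurable function $\mu:\Omega\to\mathbb{R}$ that is positive almost everywhere; a matrix weight is a measurable map $W$ from $\Omega$ to the real $d\times d$ matrices such that $W(x)$ is symmetric positive definite for almost every $x$. We say that $\mu\in A_2^{\mathrm{loc}}(\Omega)$ if for every compact $K\subset\Omega$ $$\sup_{B\subset K}\Big(\frac1{|B|}\int_B\mu\,dx\Big)\Big(\frac1{|B|}\int_B\frac1\mu\,dx\Big)<\infty ,$$ and that $W\in A_2^{\mathrm{loc}}(\Omega)$ if $W$ and $W^{-1}$ are integrable over every ball whose closure lies in $\Omega$ and for every compact $K\subset\Omega$ $$\sup_{B\subset K}\Big\|\Big(\frac1{|B|}\int_B W\,dx\Big)^{1/2}\Big(\frac1{|B|}\int_B W^{-1}\,dx\Big)^{1/2}\Big\|_{\mathrm{op}}^2<\infty ,$$ the suprema being over balls $B\subset K$. For $S\subseteq\Omega$ let $\|u\|_{L^2(S,\mu)}^2=\int_S|u|^2\mu\,dx$ and $\|v\|_{L^2(S;\mathbb{R}^d,W)}^2=\int_S|W^{1/2}v|^2\,dx=\int_S\langle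 Wv,v\rangle\,dx$; the spaces $L^2_{\mathrm{loc}}(\Omega,\mu)$ and $L^2_{\mathrm{loc}}(\Omega;\mathbb{R}^d,W)$ and convergence in them refer to all compact $S\subset\Omega$. Theorem (Muckenhoupt, Friedrichs). Let $\mu$ and $W$ be a scalar and a matrix weight in $A_2^{\mathrm{loc}}(\Omega)$, and let $u:\Omega\to\mathbb{R}$ satisfy $u\in L^2_{\mathrm{loc}}(\Omega,\mu)$ with weak gradient $\nabla u\in L^2_{\mathrm{loc}}(\Omega;\mathbb{R}^d,W)$. Then there exists a sequence $(u_n)_{n\in\mathbb{N}}$ in $C_c^\infty(\mathbb{R}^d)$ such that $$u_n\to u \ \text{ in } L^2_{\mathrm{loc}}(\Omega,\mu),$$ and, for every $\omega\subset\Omega$ whose closure is compact and contained in $\Omega$, $$\nabla u_n|_\omega\to\nabla u|_\omega \ \text{ in } L^2(\omega;\mathbb{R}^d,W).$$ -/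

import Mathlib

open MeasureTheory Filter Topology
open scoped ENNReal

noncomputable section

namespace WeightedSobolev

/-- Euclidean space `ℝ^d`. -/
abbrev E (d : ℕ) : Type := EuclideanSpace ℝ (Fin d)

/-- The positive semidefinite square root `A^{1/2}` of a positive semidefinite real matrix,
by functional calculus. -/
def matrixSqrt {d : ℕ} (A : Matrix (Fin d) (Fin d) ℝ) : Matrix (Fin d) (Fin d) ℝ :=
  cfc Real.sqrt A

/-- The operator norm of a matrix acting on Euclidean space. -/
def opNorm {d : ℕ} (A : Matrix (Fin d) (Fin d) ℝ) : ℝ :=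
  ‖Matrix.toEuclideanCLM (n := Fin d) (𝕜 := ℝ) A‖

/-- The entrywise average over `B` of a matrix-valued function, with respect to Lebesgue
measure. -/
def matrixAverage {d : ℕ} (B : Set (E d)) (W : E d → Matrix (Fin d) (Fin d) ℝ) :
    Matrix (Fin d) (Fin d) ℝ :=
  Matrix.of fun i j => ⨍ x in B, W x i j

/-- A scalar weight on `Ω`: a measurable function, positive almost everywhere. -/
structure IsScalarWeight {d : ℕ} (Ω : Set (E d)) (μ : E d → ℝ) : Prop where
  aemeasurable : AEMeasurable μ (volume.restrict Ω)
  pos : ∀ᵐ x ∂(volume.restrict Ω), 0 < μ x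

/-- A matrix weight on `Ω`: a measurable matrix-valued function whose values are almost everywhere
symmetric and positive definite. -/
structure IsMatrixWeight {d : ℕ} (Ω : Set (E d)) (W : E d → Matrix (Fin d) (Fin d) ℝ) :
    Prop where
  aemeasurable : ∀ i j, AEMeasurable (fun x => W x i j) (volume.restrict Ω)
  posDef : ∀ᵐ x ∂(volume.restrict Ω), (W x).PosDef

/-- The scalar weight `μ` belongs to the local Muckenhoupt class `A_2^loc(Ω)`. -/
structure ScalarA2Loc {d : ℕ} (Ω : Set (E d)) (μ : E d → ℝ) : Prop where
  isWeight : IsScalarWeight Ω μ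
  bound : ∀ K : Set (E d), IsCompact K → K ⊆ Ω →
    (⨆ (x : E d) (r : ℝ) (_ : 0 < r) (_ : Metric.ball x r ⊆ K),
      (⨍⁻ y in Metric.ball x r, ENNReal.ofReal (μ y) ∂volume) *
        (⨍⁻ y in Metric.ball x r, ENNReal.ofReal (1 / μ y) ∂volume)) < ∞

/-- The matrix weight `W` belongs to the local Muckenhoupt class `A_2^loc(Ω)`. The averages of
`W` and `W⁻¹` over balls are required to exist, as the finiteness of the supremum presupposes. -/
structure MatrixA2Loc {d : ℕ} (Ω : Set (E d)) (W : E d → Matrix (Fin d) (Fin d) ℝ) :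
    Prop where
  isWeight : IsMatrixWeight Ω W
  integrable : ∀ (x : E d) (r : ℝ), 0 < r → Metric.closedBall x r ⊆ Ω → ∀ i j,
    IntegrableOn (fun y => W y i j) (Metric.ball x r) ∧
      IntegrableOn (fun y => (W y)⁻¹ i j) (Metric.ball x r)
  bound : ∀ K : Set (E d), IsCompact K → K ⊆ Ω →
    (⨆ (x : E d) (r : ℝ) (_ : 0 < r) (_ : Metric.ball x r ⊆ K),
      ENNReal.ofReal
        (opNorm (matrixSqrt (matrixAverage (Metric.ball x r) W) *
          matrixSqrt (matrixAverage (Metric.ball x r) fun y => (W y)⁻¹)) ^ 2)) < ∞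

/-- The squared norm `∫_S |u|² μ dx` of `L²(S, μ)`. -/
def scalarSqNorm {d : ℕ} (S : Set (E d)) (μ : E d → ℝ) (u : E d → ℝ) : ℝ≥0∞ :=
  ∫⁻ x in S, ENNReal.ofReal (μ x * u x ^ 2)

/-- The squared norm `∫_S |W^{1/2} v|² dx = ∫_S ⟨W v, v⟩ dx` of `L²(S; ℝ^d, W)`. -/
def vectorSqNorm {d : ℕ} (S : Set (E d)) (W : E d → Matrix (Fin d) (Fin d) ℝ)
    (v : E d → E d) : ℝ≥0∞ :=
  ∫⁻ x in S, ENNReal.ofReal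
    (inner ℝ (Matrix.toEuclideanCLM (n := Fin d) (𝕜 := ℝ) (W x) (v x)) (v x))

/-- `u ∈ L²(S, μ)`. -/
def MemScalarL2 {d : ℕ} (S : Set (E d)) (μ : E d → ℝ) (u : E d → ℝ) : Prop :=
  AEMeasurable u (volume.restrict S) ∧ scalarSqNorm S μ u < ∞

/-- `v ∈ L²(S; ℝ^d, W)`. -/
def MemVectorL2 {d : ℕ} (S : Set (E d)) (W : E d → Matrix (Fin d) (Fin d) ℝ)
    (v : E d → E d) : Prop :=
  AEMeasurable v (volume.restrict S) ∧ vectorSqNorm S W v < ∞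

/-- `u ∈ L²_loc(Ω, μ)`. -/
def MemScalarL2Loc {d : ℕ} (Ω : Set (E d)) (μ : E d → ℝ) (u : E d → ℝ) : Prop :=
  ∀ K : Set (E d), IsCompact K → K ⊆ Ω → MemScalarL2 K μ u

/-- `v ∈ L²_loc(Ω; ℝ^d, W)`. -/
def MemVectorL2Loc {d : ℕ} (Ω : Set (E d)) (W : E d → Matrix (Fin d) (Fin d) ℝ)
    (v : E d → E d) : Prop :=
  ∀ K : Set (E d), IsCompact K → K ⊆ Ω → MemVectorL2 K W v

/-- The functions `u_n` and `u` belong to `L²(S, μ)` and `u_n → u` in that space. -/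
def TendstoScalarL2 {d : ℕ} (S : Set (E d)) (μ : E d → ℝ) (un : ℕ → E d → ℝ)
    (u : E d → ℝ) : Prop :=
  (∀ n, MemScalarL2 S μ (un n)) ∧ MemScalarL2 S μ u ∧
    Tendsto (fun n => scalarSqNorm S μ (un n - u)) atTop (𝓝 0)

/-- The fields `v_n` and `v` belong to `L²(S; ℝ^d, W)` and `v_n → v` in that space. -/
def TendstoVectorL2 {d : ℕ} (S : Set (E d)) (W : E d → Matrix (Fin d) (Fin d) ℝ)
    (vn : ℕ → E d → E d) (v : E d → E d) : Prop :=
  (∀ n, MemVectorL2 S W (vn n)) ∧ MemVectorL2 S W v ∧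
    Tendsto (fun n => vectorSqNorm S W (vn n - v)) atTop (𝓝 0)

/-- `u_n → u` in `L²_loc(Ω, μ)`. -/
def TendstoScalarL2Loc {d : ℕ} (Ω : Set (E d)) (μ : E d → ℝ) (un : ℕ → E d → ℝ)
    (u : E d → ℝ) : Prop :=
  ∀ K : Set (E d), IsCompact K → K ⊆ Ω → TendstoScalarL2 K μ un u

/-- `g` is the weak gradient of `u` on the open set `Ω`: both are locally integrable on `Ω` and
`∫ u ∇φ = - ∫ φ g` for all test functions `φ ∈ C_c^∞(Ω)`. -/
structure IsWeakGradientOn {d : ℕ} (Ω : Set (E d)) (u : E d → ℝ) (g : E d → E d) :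
    Prop where
  locallyIntegrable : LocallyIntegrableOn u Ω
  locallyIntegrable_grad : LocallyIntegrableOn g Ω
  integral_eq : ∀ φ : E d → ℝ, ContDiff ℝ (⊤ : ℕ∞) φ → HasCompactSupport φ → tsupport φ ⊆ Ω →
    ∫ x in Ω, u x • gradient φ x = - ∫ x in Ω, φ x • g x

/-- `u` belongs to the weighted local Sobolev space on `Ω` with weights `(μ, W)`, and `g` is its
weak gradient. -/
structure MemSobolevLoc {d : ℕ} (Ω : Set (E d)) (μ : E d → ℝ)
    (W : E d → Matrix (Fin d) (Fin d) ℝ) (u : E d → ℝ) (g : E d → E d) : Prop where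
  memL2Loc : MemScalarL2Loc Ω μ u
  isWeakGradient : IsWeakGradientOn Ω u g
  grad_memL2Loc : MemVectorL2Loc Ω W g

end WeightedSobolev

end

/-!
The approximants are mollifications `ρ_δ * (1_{K'} u)`, where `K'` is a compact neighbourhood in `Ω`
of the compact set on which the error is measured. Testing the definition of the weak gradient with
the translates `y ↦ ρ_δ (x - y)` shows that the gradient of the mollification is the mollification
of the weak gradient as long as the `δ`-ball around `x` stays in `K'`
(`IsWeakGradientOn.hasGradientAt_convolution`). What remains is that mollification converges in the
weighted spaces, and this is proved once for both kinds of weight: `IsA2Form` is a field of squared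
seminorms `q x v = ‖A_x v‖²` with `q x v ≤ M x y * q y v`, where the mean of `M` over `B × B` is
bounded for balls `B`. For a scalar weight `M x y = μ x / μ y`. For a matrix weight
`M x y = tr (W x (W y)⁻¹)`, the squared Hilbert–Schmidt norm of `W(x)^{1/2} W(y)^{-1/2}`, whose mean
is the trace of the product of the two averages in the `A_2` condition, hence is bounded by `d`
times the squared operator norm (`trace_mul_le`).

The mollifications are uniformly bounded on these spaces without the maximal theorem
(`IsA2Form.exists_lintegral_convolution_le`). The triangle inequality and the Cauchy–Schwarz
inequality give, with `|B|` the volume of a ball of radius `δ`,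
`q x (ρ_δ * h (x)) ≤ (2^d / |B|)² ∫_{B(x,δ)} M x y dy ∫_{B(x,δ)} q y (h y) dy`.
Integrating over `x ∈ B(z,δ)`, the right-hand side is controlled on `B(z,2δ)` by the `A_2` condition,
and averaging over all centres `z` yields the global bound by Tonelli's theorem. Continuous functions
with compact support are dense, and their mollifications converge uniformly, so mollification
converges on the whole space (`IsA2Form.tendsto_lintegral_convolution_sub`). A compact exhaustion of
`Ω` then turns approximation on a single compact set into a sequence.
-/

namespace WeightedSobolev

open Metric Set
open scoped Convolution

/-! ### Quadratic forms of Muckenhoupt type -/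

/-- A measurable field `q x v = ‖A_x v‖²` of squared Hilbert seminorms on `F` over `ℝ^d`, which on
`Ω` behaves like the quadratic form of a local `A_2` weight. The function `w` dominates the form
and is locally integrable; the kernel `M x y` bounds the ratio of the forms at `x` and at `y`, and
its mean over `B × B` is bounded for balls `B` inside a compact set. For a scalar weight,
`M x y = μ x / μ y`; for a matrix weight, `w = tr W` and `M x y = tr (W x (W y)⁻¹)`. -/
structure IsA2Form {d : ℕ} {F : Type*} [NormedAddCommGroup F] [NormedSpace ℝ F]
    [MeasurableSpace F] (Ω : Set (E d)) (q : E d → F → ℝ≥0∞) (w : E d → ℝ≥0∞)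
    (M : E d → E d → ℝ≥0∞) : Prop where
  measurable : Measurable (Function.uncurry q)
  eq_enorm_sq : ∀ x, ∃ A : F →L[ℝ] F, ∀ v, q x v = ‖A v‖ₑ ^ 2
  measurable_dom : Measurable w
  le_dom : ∀ x v, q x v ≤ w x * ‖v‖ₑ ^ 2
  lintegral_dom : ∀ K, IsCompact K → K ⊆ Ω → ∫⁻ x in K, w x < ∞
  measurable_ratio : Measurable (Function.uncurry M)
  le_ratio : ∀ x y v, q x v ≤ M x y * q y v
  lintegral_ratio : ∀ K, IsCompact K → K ⊆ Ω → ∃ C : ℝ≥0∞, C < ∞ ∧ ∀ x r, 0 < r → ball x r ⊆ K →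
    ∫⁻ y in ball x r, ∫⁻ z in ball x r, M y z ≤ C * volume (ball x r) ^ 2

/-- The Cauchy–Schwarz inequality for a function whose square is dominated by a product. -/
lemma lintegral_sq_le_of_sq_le_mul {α : Type*} [MeasurableSpace α] {ν : Measure α}
    {h a b : α → ℝ≥0∞} (ha : AEMeasurable a ν) (hb : AEMeasurable b ν)
    (H : ∀ x, h x ^ 2 ≤ a x * b x) :
    (∫⁻ x, h x ∂ν) ^ 2 ≤ (∫⁻ x, a x ∂ν) * ∫⁻ x, b x ∂ν := by
  have e2 (t : ℝ≥0∞) : (t ^ (1 / 2 : ℝ)) ^ (2 : ℝ) = t := by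
    rw [← ENNReal.rpow_mul]; norm_num
  have e2' (t : ℝ≥0∞) : (t ^ (1 / 2 : ℝ)) ^ 2 = t := by
    rw [← ENNReal.rpow_natCast, ← ENNReal.rpow_mul]; norm_num
  have h1 : ∫⁻ x, h x ∂ν ≤ ∫⁻ x, ((fun x => a x ^ (1 / 2 : ℝ)) * fun x => b x ^ (1 / 2 : ℝ)) x ∂ν := by
    refine lintegral_mono fun x => ?_
    have := ENNReal.rpow_le_rpow (H x) (z := 1 / 2) (by norm_num)
    rwa [← ENNReal.rpow_natCast, ← ENNReal.rpow_mul, ENNReal.mul_rpow_of_nonneg _ _ (by norm_num),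
      show ((2 : ℕ) : ℝ) * (1 / 2) = 1 by norm_num, ENNReal.rpow_one] at this
  have h2 := h1.trans (ENNReal.lintegral_mul_le_Lp_mul_Lq ν (p := 2) (q := 2)
    (by rw [Real.holderConjugate_iff]; norm_num) (ha.pow_const _) (hb.pow_const _))
  simp only [e2] at h2
  calc (∫⁻ x, h x ∂ν) ^ 2
      ≤ ((∫⁻ x, a x ∂ν) ^ (1 / 2 : ℝ) * (∫⁻ x, b x ∂ν) ^ (1 / 2 : ℝ)) ^ 2 := by gcongr
    _ = _ := by rw [mul_pow, e2', e2']

lemma volume_ball_two_mul {d : ℕ} (z : E d) (δ : ℝ) :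
    volume (ball z (2 * δ)) = 2 ^ d * volume (ball (0 : E d) δ) := by
  rw [Measure.addHaar_ball_mul_of_pos _ _ (by norm_num : (0 : ℝ) < 2), finrank_euclideanSpace,
    Fintype.card_fin, ENNReal.ofReal_pow (by norm_num)]
  norm_num

/-- Integrating a function over all balls of radius `δ` multiplies its integral by the volume of
such a ball. -/
lemma lintegral_lintegral_ball {d : ℕ} {G : E d → ℝ≥0∞} (hG : Measurable G) (δ : ℝ) :
    ∫⁻ z, ∫⁻ x in ball z δ, G x = volume (ball (0 : E d) δ) * ∫⁻ x, G x := by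
  have hD : MeasurableSet {p : E d × E d | dist p.2 p.1 < δ} :=
    measurableSet_lt (measurable_snd.dist measurable_fst) measurable_const
  have hm : Measurable fun p : E d × E d =>
      {p : E d × E d | dist p.2 p.1 < δ}.indicator (fun p => G p.2) p :=
    (hG.comp measurable_snd).indicator hD
  calc ∫⁻ z, ∫⁻ x in ball z δ, G x
      = ∫⁻ z, ∫⁻ x, {p : E d × E d | dist p.2 p.1 < δ}.indicator (fun p => G p.2) (z, x) := by
        refine lintegral_congr fun z => ?_
        rw [← lintegral_indicator measurableSet_ball]
        rfl
    _ = ∫⁻ x, ∫⁻ z, {p : E d × E d | dist p.2 p.1 < δ}.indicator (fun p => G p.2) (z, x) :=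
        lintegral_lintegral_swap hm.aemeasurable
    _ = ∫⁻ x, volume (ball (0 : E d) δ) * G x := by
        refine lintegral_congr fun x => ?_
        rw [← Measure.addHaar_ball_center volume x, mul_comm, ← setLIntegral_const,
          ← lintegral_indicator measurableSet_ball]
        refine lintegral_congr fun z => ?_
        simp only [indicator, mem_ofPred_eq, mem_ball, dist_comm]
    _ = _ := lintegral_const_mul _ hG

/-! ### Uniform boundedness of mollifications -/

section Form

variable {d : ℕ} {F : Type*} [NormedAddCommGroup F] [NormedSpace ℝ F] [MeasurableSpace F]
  {Ω : Set (E d)} {q : E d → F → ℝ≥0∞} {w : E d → ℝ≥0∞} {M : E d → E d → ℝ≥0∞}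

namespace IsA2Form

lemma measurable_comp (hq : IsA2Form Ω q w M) {f : E d → F} (hf : Measurable f) :
    Measurable fun x => q x (f x) :=
  hq.measurable.comp (measurable_id.prodMk hf)

lemma add_le (hq : IsA2Form Ω q w M) (x : E d) (u v : F) :
    q x (u + v) ≤ 2 * (q x u + q x v) := by
  obtain ⟨A, hA⟩ := hq.eq_enorm_sq x
  simp only [hA, map_add]
  calc ‖A u + A v‖ₑ ^ 2 ≤ (‖A u‖ₑ + ‖A v‖ₑ) ^ 2 := by gcongr; exact enorm_add_le _ _
    _ ≤ 2 * (‖A u‖ₑ ^ 2 + ‖A v‖ₑ ^ 2) := by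
      have := ENNReal.rpow_add_le_mul_rpow_add_rpow ‖A u‖ₑ ‖A v‖ₑ (p := 2) (by norm_num)
      norm_num at this
      exact this

lemma sub_comm (hq : IsA2Form Ω q w M) (x : E d) (u v : F) : q x (u - v) = q x (v - u) := by
  obtain ⟨A, hA⟩ := hq.eq_enorm_sq x
  rw [hA, hA, map_sub, map_sub, ← enorm_neg, neg_sub]

lemma apply_zero (hq : IsA2Form Ω q w M) (x : E d) : q x 0 = 0 := by
  obtain ⟨A, hA⟩ := hq.eq_enorm_sq x
  simp [hA]

/-- Pointwise bound for a mollification: the triangle inequality for the seminorm at `x`, followed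
by the comparison with the seminorm at `y` and the Cauchy–Schwarz inequality. -/
lemma convolution_le [FiniteDimensional ℝ F] [BorelSpace F] (hq : IsA2Form Ω q w M) {h : E d → F}
    (hh : Measurable h) (φ : ContDiffBump (0 : E d)) (hφ : φ.rOut ≤ 2 * φ.rIn) (x : E d) :
    q x ((φ.normed volume ⋆[ContinuousLinearMap.lsmul ℝ ℝ, volume] h) x) ≤
      (2 ^ d / volume (ball (0 : E d) φ.rOut)) ^ 2 *
        ((∫⁻ y in ball x φ.rOut, M x y) * ∫⁻ y in ball x φ.rOut, q y (h y)) := by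
  have : CompleteSpace F := FiniteDimensional.complete ℝ F
  set κ : ℝ≥0∞ := 2 ^ d / volume (ball (0 : E d) φ.rOut)
  have hκ (y : E d) : ‖φ.normed volume y‖ₑ ≤ κ := by
    have h0 : 0 < (volume : Measure (E d)).real (ball (0 : E d) φ.rOut) :=
      ENNReal.toReal_pos (measure_ball_pos _ _ φ.rOut_pos).ne' measure_ball_lt_top.ne
    have h1 := φ.normed_le_div_measure_closedBall_rOut volume 2 hφ y
    rw [finrank_euclideanSpace, Fintype.card_fin] at h1
    have h2 : φ.normed volume y ≤ 2 ^ d / (volume : Measure (E d)).real (ball (0 : E d) φ.rOut) := by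
      refine h1.trans ?_
      gcongr
      · exact measure_closedBall_lt_top.ne
      · exact ball_subset_closedBall
    rw [Real.enorm_of_nonneg (φ.nonneg_normed y)]
    refine (ENNReal.ofReal_le_ofReal h2).trans ?_
    rw [ENNReal.ofReal_div_of_pos h0, ofReal_measureReal measure_ball_lt_top.ne,
      ENNReal.ofReal_pow (by norm_num)]
    norm_num [κ]
  obtain ⟨A, hA⟩ := hq.eq_enorm_sq x
  have h1 : ‖A ((φ.normed volume ⋆[ContinuousLinearMap.lsmul ℝ ℝ, volume] h) x)‖ₑ ≤
      ∫⁻ y in ball x φ.rOut, κ * ‖A (h y)‖ₑ := by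
    rw [convolution_eq_swap]
    simp only [ContinuousLinearMap.lsmul_apply]
    by_cases hi : Integrable fun y => φ.normed volume (x - y) • h y
    · rw [← A.integral_comp_comm hi]
      refine (enorm_integral_le_lintegral_enorm _).trans ?_
      rw [← lintegral_indicator measurableSet_ball]
      refine lintegral_mono fun y => ?_
      by_cases hy : y ∈ ball x φ.rOut
      · rw [indicator_of_mem hy, map_smul, enorm_smul]
        gcongr
        exact hκ _
      · have : φ.normed volume (x - y) = 0 := by
          rw [← Function.notMem_support, φ.support_normed_eq, mem_ball_zero_iff, ← dist_eq_norm,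
            dist_comm]
          exact hy
        simp [this]
    -- Without integrability the convolution is `0` by convention.
    · simp [integral_undef hi]
  rw [hA]
  have hAm : Measurable fun y => ‖A (h y)‖ₑ := (A.continuous.measurable.comp hh).enorm
  calc _ ≤ (∫⁻ y in ball x φ.rOut, κ * ‖A (h y)‖ₑ) ^ 2 := by gcongr
    _ = κ ^ 2 * (∫⁻ y in ball x φ.rOut, ‖A (h y)‖ₑ) ^ 2 := by
      rw [lintegral_const_mul _ hAm, mul_pow]
    _ ≤ _ := by
      gcongr
      refine lintegral_sq_le_of_sq_le_mul
        (hq.measurable_ratio.comp (measurable_const.prodMk measurable_id)).aemeasurable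
        (hq.measurable_comp hh).aemeasurable fun y => ?_
      rw [← hA]
      exact hq.le_ratio x y (h y)

/-- Mollifications at small scales are uniformly bounded between weighted spaces. Averaging the
pointwise bound over all balls of radius `δ` reduces the claim to a single ball, where it is the
`A_2` condition; no covering argument and no maximal function is needed. -/
lemma exists_lintegral_convolution_le [FiniteDimensional ℝ F] [BorelSpace F]
    (hq : IsA2Form Ω q w M) {K K' : Set (E d)} (hK : IsCompact K) (hK' : IsCompact K')
    (hK'Ω : K' ⊆ Ω) {δ₀ : ℝ} (hδ₀ : cthickening (3 * δ₀) K ⊆ K') :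
    ∃ C : ℝ≥0∞, C < ∞ ∧ ∀ (φ : ContDiffBump (0 : E d)), φ.rOut ≤ 2 * φ.rIn → φ.rOut ≤ δ₀ →
      ∀ h : E d → F, Measurable h →
      ∫⁻ x in K, q x ((φ.normed volume ⋆[ContinuousLinearMap.lsmul ℝ ℝ, volume] h) x) ≤
        C * ∫⁻ x in K', q x (h x) := by
  obtain ⟨C, hC, hCb⟩ := hq.lintegral_ratio K' hK' hK'Ω
  refine ⟨(2 ^ d) ^ 5 * C, by finiteness, fun φ hφ hφδ h hh => ?_⟩
  set δ := φ.rOut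
  have hδ : 0 < δ := φ.rOut_pos
  set V := volume (ball (0 : E d) δ)
  have hV0 : V ≠ 0 := (measure_ball_pos _ _ hδ).ne'
  have hVt : V ≠ ∞ := measure_ball_lt_top.ne
  set κ : ℝ≥0∞ := 2 ^ d / V
  have hN : Measurable fun y => q y (h y) := hq.measurable_comp hh
  let G : E d → ℝ≥0∞ := fun x =>
    κ ^ 2 * ((∫⁻ y in ball x δ, M x y) * ∫⁻ y in ball x δ, q y (h y))
  have hD : MeasurableSet {p : E d × E d | dist p.2 p.1 < δ} :=
    measurableSet_lt (measurable_snd.dist measurable_fst) measurable_const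
  have hball {a : E d → E d → ℝ≥0∞} (ha : Measurable (Function.uncurry a)) :
      Measurable fun x => ∫⁻ y in ball x δ, a x y := by
    have := (ha.indicator hD).lintegral_prod_right' (ν := (volume : Measure (E d)))
    convert this using 2 with x
    rw [← lintegral_indicator measurableSet_ball]
    rfl
  have hG : Measurable G := by
    refine Measurable.const_mul (Measurable.mul (hball hq.measurable_ratio) ?_) _
    exact hball (a := fun _ y => q y (h y)) (hN.comp measurable_snd)
  -- The bound on a single ball: its double lies in `K'` if it meets `K`, and otherwise the left-hand
  -- side is zero.
  have key (z : E d) : ∫⁻ x in ball z δ, K.indicator G x ≤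
      (κ ^ 2 * (C * (2 ^ d * V) ^ 2)) *
        ∫⁻ x in ball z (2 * δ), K'.indicator (fun y => q y (h y)) x := by
    by_cases hz : (ball z δ ∩ K).Nonempty
    · obtain ⟨p, hpz, hpK⟩ := hz
      have hsub : ball z (2 * δ) ⊆ K' := by
        refine Subset.trans (fun y hy => ?_) hδ₀
        refine mem_cthickening_of_dist_le y p _ _ hpK ?_
        have := dist_triangle y z p
        have h1 : dist p z < δ := hpz
        have h2 : dist y z < 2 * δ := hy
        rw [dist_comm p z] at h1
        linarith
      have e1 : ∫⁻ x in ball z (2 * δ), K'.indicator (fun y => q y (h y)) x =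
          ∫⁻ x in ball z (2 * δ), q x (h x) :=
        setLIntegral_congr_fun measurableSet_ball fun x hx => indicator_of_mem (hsub hx) _
      rw [e1]
      set I := ∫⁻ x in ball z (2 * δ), q x (h x)
      calc ∫⁻ x in ball z δ, K.indicator G x
          ≤ ∫⁻ x in ball z δ, κ ^ 2 * ((∫⁻ y in ball z (2 * δ), M x y) * I) := by
            refine setLIntegral_mono' measurableSet_ball fun x hx => ?_
            have hs : ball x δ ⊆ ball z (2 * δ) :=
              ball_subset_ball' (by have : dist x z < δ := hx
                                    linarith)
            refine (indicator_le_self K G x).trans ?_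
            simp only [G]
            gcongr
            exact lintegral_mono_set hs
        _ ≤ ∫⁻ x in ball z (2 * δ), κ ^ 2 * ((∫⁻ y in ball z (2 * δ), M x y) * I) :=
            lintegral_mono_set (ball_subset_ball (by linarith))
        _ = κ ^ 2 * ((∫⁻ x in ball z (2 * δ), ∫⁻ y in ball z (2 * δ), M x y) * I) := by
            have : Measurable fun x => ∫⁻ y in ball z (2 * δ), M x y :=
              hq.measurable_ratio.lintegral_prod_right'
            rw [lintegral_const_mul _ (this.mul_const _), lintegral_mul_const _ this]
        _ ≤ κ ^ 2 * ((C * volume (ball z (2 * δ)) ^ 2) * I) := by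
            gcongr
            exact hCb z (2 * δ) (by linarith) hsub
        _ = _ := by rw [volume_ball_two_mul]; ring
    · have : ∫⁻ x in ball z δ, K.indicator G x = 0 := by
        rw [setLIntegral_congr_fun (g := 0) measurableSet_ball fun x hx => ?_]
        · simp
        · exact indicator_of_notMem (fun hxK => hz ⟨x, hx, hxK⟩) _
      rw [this]
      exact zero_le
  have hNK : Measurable (K'.indicator fun y => q y (h y)) := hN.indicator hK'.measurableSet
  -- Integrate the bound over the centres `z`; by `lintegral_lintegral_ball` both sides become multiples
  -- of integrals over the whole space.
  have h1 : V * ∫⁻ x in K, G x ≤ V * ((2 ^ d) ^ 5 * C * ∫⁻ x in K', q x (h x)) := by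
    rw [← lintegral_indicator hK.measurableSet, ← lintegral_indicator hK'.measurableSet,
      ← lintegral_lintegral_ball (hG.indicator hK.measurableSet)]
    refine (lintegral_mono key).trans ?_
    rw [lintegral_const_mul', lintegral_lintegral_ball hNK, volume_ball_two_mul]
    · have hκ : κ * V = 2 ^ d := ENNReal.div_mul_cancel hV0 hVt
      refine le_of_eq ?_
      calc _ = (κ * V) ^ 2 * (2 ^ d) ^ 3 * C * V * ∫⁻ x, K'.indicator (fun y => q y (h y)) x := by
            ring
        _ = _ := by rw [hκ]; ring
    · have : κ < ∞ := ENNReal.div_lt_top (by finiteness) hV0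
      finiteness
  refine (setLIntegral_mono' hK.measurableSet fun x _ => hq.convolution_le hh φ hφ x).trans ?_
  exact (ENNReal.mul_le_mul_iff_right hV0 hVt).1 h1

/-! ### Convergence of mollifications -/

lemma measurable_comp_sub [FiniteDimensional ℝ F] [BorelSpace F] (hq : IsA2Form Ω q w M)
    {u v : E d → F} (hu : Measurable u) (hv : Measurable v) :
    Measurable fun x => q x (u x - v x) := by
  have : ProperSpace F := FiniteDimensional.proper ℝ F
  exact hq.measurable_comp (hu.sub hv)

/-- Continuous functions with compact support are dense in the weighted space: a truncation reduces
to bounded functions, on which the weighted norm is dominated by that of `L²(w dx)`. -/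
lemma exists_continuous_lintegral_sub_le [FiniteDimensional ℝ F] [BorelSpace F]
    (hq : IsA2Form Ω q w M) {K : Set (E d)} (hK : IsCompact K) (hKΩ : K ⊆ Ω) {f : E d → F}
    (hf : Measurable f) (hfi : ∫⁻ x in K, q x (f x) < ∞) {ε : ℝ≥0∞} (hε : ε ≠ 0) :
    ∃ h : E d → F, Continuous h ∧ HasCompactSupport h ∧ ∫⁻ x in K, q x (f x - h x) ≤ ε := by
  have : ProperSpace F := FiniteDimensional.proper ℝ F
  -- `g n` is the truncation of `f` at height `n`.
  let g : ℕ → E d → F := fun n => {x | ‖f x‖ ≤ n}.indicator f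
  have hg (n) : Measurable (g n) := hf.indicator (measurableSet_le hf.norm measurable_const)
  have hlim : Tendsto (fun n => ∫⁻ x in K, q x (f x - g n x)) atTop (𝓝 0) := by
    have := tendsto_lintegral_of_dominated_convergence (μ := volume.restrict K)
      (F := fun n x => q x (f x - g n x)) (f := fun _ => 0) (fun x => q x (f x))
      (fun n => hq.measurable_comp (hf.sub (hg n))) (fun n => ae_of_all _ fun x => ?_) hfi.ne
      (ae_of_all _ fun x => ?_)
    · simpa using this
    · by_cases hx : ‖f x‖ ≤ n
      · have : g n x = f x := indicator_of_mem (s := {x | ‖f x‖ ≤ n}) hx f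
        simp [this, hq.apply_zero]
      · have : g n x = 0 := indicator_of_notMem (s := {x | ‖f x‖ ≤ n}) hx f
        simp [this]
    · refine tendsto_const_nhds.congr' ?_
      filter_upwards [eventually_ge_atTop ⌈‖f x‖⌉₊] with n hn
      have : g n x = f x := indicator_of_mem (s := {x | ‖f x‖ ≤ n}) (Nat.ceil_le.1 hn) f
      simp [this, hq.apply_zero]
  obtain ⟨n, hn⟩ := (ENNReal.tendsto_nhds_zero.1 hlim (ε / 4)
    (ENNReal.div_pos hε (by finiteness))).exists
  let ν : Measure (E d) := (volume.restrict K).withDensity w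
  have : IsFiniteMeasure ν := isFiniteMeasure_withDensity (hq.lintegral_dom K hK hKΩ).ne
  have hgL : MemLp (g n) 2 ν := by
    refine MemLp.of_bound (hg n).aestronglyMeasurable n (ae_of_all _ fun x => ?_)
    by_cases hx : ‖f x‖ ≤ n
    · have : g n x = f x := indicator_of_mem (s := {x | ‖f x‖ ≤ n}) hx f
      rwa [this]
    · have : g n x = 0 := indicator_of_notMem (s := {x | ‖f x‖ ≤ n}) hx f
      simp [this]
  obtain ⟨η, hη0, hη⟩ : ∃ η : ℝ≥0∞, η ≠ 0 ∧ η ^ 2 ≤ ε / 4 := by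
    refine ⟨(ε / 4) ^ (1 / 2 : ℝ), ?_, ?_⟩
    · rw [ne_eq, ENNReal.rpow_eq_zero_iff_of_pos (by norm_num)]
      exact (ENNReal.div_pos hε (by finiteness)).ne'
    · rw [← ENNReal.rpow_natCast, ← ENNReal.rpow_mul]; norm_num
  obtain ⟨h, hhc, hhε, hh, -⟩ := hgL.exists_hasCompactSupport_eLpNorm_sub_le (by norm_num) hη0
  refine ⟨h, hh, hhc, ?_⟩
  have h2 : ∫⁻ x in K, q x (g n x - h x) ≤ ε / 4 := by
    calc ∫⁻ x in K, q x (g n x - h x) ≤ ∫⁻ x in K, w x * ‖g n x - h x‖ₑ ^ 2 :=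
          lintegral_mono fun x => hq.le_dom x _
      _ = ∫⁻ x, ‖g n x - h x‖ₑ ^ 2 ∂ν := by
          have hm : Measurable fun x => ‖g n x - h x‖ₑ ^ 2 :=
            ((hg n).sub hh.measurable).enorm.pow_const 2
          rw [lintegral_withDensity_eq_lintegral_mul _ hq.measurable_dom hm]
          rfl
      _ = eLpNorm (g n - h) 2 ν ^ 2 := by
          have := eLpNorm_nnreal_pow_eq_lintegral (f := g n - h) (μ := ν) (p := 2) (by norm_num)
          norm_num at this
          rw [this]
      _ ≤ η ^ 2 := by gcongr
      _ ≤ _ := hη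
  calc ∫⁻ x in K, q x (f x - h x)
      ≤ ∫⁻ x in K, 2 * (q x (f x - g n x) + q x (g n x - h x)) := by
        refine lintegral_mono fun x => ?_
        rw [← sub_add_sub_cancel (f x) (g n x) (h x)]
        exact hq.add_le x _ _
    _ = 2 * ((∫⁻ x in K, q x (f x - g n x)) + ∫⁻ x in K, q x (g n x - h x)) := by
        rw [lintegral_const_mul' _ _ (by norm_num),
          lintegral_add_left (hq.measurable_comp_sub hf (hg n))]
    _ ≤ 2 * (ε / 4 + ε / 4) := by gcongr
    _ = ε := by
        rw [← two_mul, ← mul_assoc, show (2 : ℝ≥0∞) * 2 = 4 by norm_num]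
        exact ENNReal.mul_div_cancel (by norm_num) (by norm_num)

/-- Mollifications of a continuous function with compact support converge uniformly, hence in the
weighted space over a compact set. -/
lemma tendsto_lintegral_convolution_sub_of_continuous [FiniteDimensional ℝ F]
    (hq : IsA2Form Ω q w M) {K : Set (E d)} (hK : IsCompact K) (hKΩ : K ⊆ Ω) {h : E d → F}
    (hh : Continuous h) (hhc : HasCompactSupport h) {φ : ℕ → ContDiffBump (0 : E d)}
    (hφ : Tendsto (fun n => (φ n).rOut) atTop (𝓝 0)) :
    Tendsto (fun n => ∫⁻ x in K,
      q x (((φ n).normed volume ⋆[ContinuousLinearMap.lsmul ℝ ℝ, volume] h) x - h x))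
      atTop (𝓝 0) := by
  have : CompleteSpace F := FiniteDimensional.complete ℝ F
  have : ProperSpace F := FiniteDimensional.proper ℝ F
  have hw := hq.lintegral_dom K hK hKΩ
  have hη : Tendsto (fun t : ℝ => (∫⁻ x in K, w x) * ENNReal.ofReal t ^ 2) (𝓝[>] 0) (𝓝 0) := by
    have : Continuous fun t : ℝ => (∫⁻ x in K, w x) * ENNReal.ofReal t ^ 2 :=
      (ENNReal.continuous_const_mul hw.ne).comp
        ((ENNReal.continuous_pow 2).comp ENNReal.continuous_ofReal)
    simpa using (this.tendsto 0).mono_left nhdsWithin_le_nhds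
  rw [ENNReal.tendsto_nhds_zero] at hη ⊢
  intro ε hε
  obtain ⟨t, ht, ht0⟩ := ((hη ε hε).and self_mem_nhdsWithin).exists
  obtain ⟨δ, hδ, huc⟩ := Metric.uniformContinuous_iff.1
    (hhc.uniformContinuous_of_continuous hh) t ht0
  filter_upwards [hφ.eventually_lt_const hδ] with n hn
  refine le_trans ?_ ht
  rw [← lintegral_mul_const _ hq.measurable_dom]
  refine lintegral_mono fun x => (hq.le_dom x _).trans ?_
  gcongr
  rw [← ofReal_norm, ← dist_eq_norm]
  refine ENNReal.ofReal_le_ofReal ?_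
  exact ContDiffBump.dist_normed_convolution_le hh.aestronglyMeasurable fun y hy =>
    (huc ((mem_ball.1 hy).trans hn)).le

/-- Mollifications converge in the weighted space over compact subsets of `Ω`. -/
theorem tendsto_lintegral_convolution_sub [FiniteDimensional ℝ F] [BorelSpace F]
    (hq : IsA2Form Ω q w M) (hΩ : IsOpen Ω) {K : Set (E d)} (hK : IsCompact K) (hKΩ : K ⊆ Ω)
    {f : E d → F} (hf : Measurable f) (hfl : LocallyIntegrable f)
    (hfi : ∀ K', IsCompact K' → K' ⊆ Ω → ∫⁻ x in K', q x (f x) < ∞)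
    {φ : ℕ → ContDiffBump (0 : E d)} (hφ2 : ∀ n, (φ n).rOut ≤ 2 * (φ n).rIn)
    (hφ : Tendsto (fun n => (φ n).rOut) atTop (𝓝 0)) :
    Tendsto (fun n => ∫⁻ x in K,
      q x (((φ n).normed volume ⋆[ContinuousLinearMap.lsmul ℝ ℝ, volume] f) x - f x))
      atTop (𝓝 0) := by
  have : CompleteSpace F := FiniteDimensional.complete ℝ F
  have : ProperSpace F := FiniteDimensional.proper ℝ F
  obtain ⟨δ₁, hδ₁, hsub⟩ := hK.exists_cthickening_subset_open hΩ hKΩ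
  have hK' : IsCompact (cthickening δ₁ K) := hK.cthickening
  obtain ⟨C, hC, hCb⟩ := hq.exists_lintegral_convolution_le hK hK' hsub (δ₀ := δ₁ / 3)
    (by rw [mul_div_cancel₀ _ (by norm_num : (3 : ℝ) ≠ 0)])
  rw [ENNReal.tendsto_nhds_zero]
  intro ε hε
  have hC0 : 2 * C + 8 ≠ 0 := by simp
  have hCt : 2 * C + 8 ≠ ∞ := by finiteness
  obtain ⟨h, hh, hhc, hfh⟩ := hq.exists_continuous_lintegral_sub_le hK' hsub hf (hfi _ hK' hsub)
    (ε := ε / (2 * C + 8)) (ENNReal.div_pos hε.ne' hCt).ne'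
  set η := ε / (2 * C + 8)
  have hη : 0 < η := ENNReal.div_pos hε.ne' hCt
  have hlim := ENNReal.tendsto_nhds_zero.1
    (hq.tendsto_lintegral_convolution_sub_of_continuous hK hKΩ hh hhc hφ) η hη
  filter_upwards [hlim, hφ.eventually_le_const (show 0 < δ₁ / 3 by positivity)] with n hn hnδ
  have hcs := (φ n).hasCompactSupport_normed (μ := (volume : Measure (E d)))
  have hcc := (φ n).continuous_normed (μ := (volume : Measure (E d)))
  set ψ := (φ n).normed volume
  let L : ℝ →L[ℝ] F →L[ℝ] F := ContinuousLinearMap.lsmul ℝ ℝ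
  have ef : ConvolutionExists ψ f L volume := hcs.convolutionExists_left L hcc hfl
  have eh : ConvolutionExists ψ h L volume :=
    hcs.convolutionExists_left L hcc hh.locallyIntegrable
  have hsubst (x) : (ψ ⋆[L, volume] (f - h)) x = (ψ ⋆[L, volume] f) x - (ψ ⋆[L, volume] h) x := by
    simp only [convolution_def, Pi.sub_apply, map_sub]
    exact integral_sub (ef x) (eh x)
  have mh : Measurable (ψ ⋆[L, volume] h) :=
    (hcs.continuous_convolution_left L hcc hh.locallyIntegrable).measurable
  have mf : Measurable (ψ ⋆[L, volume] f) :=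
    (hcs.continuous_convolution_left L hcc hfl).measurable
  have b1 : ∫⁻ x in K, q x ((ψ ⋆[L, volume] f) x - (ψ ⋆[L, volume] h) x) ≤ C * η := by
    simp only [← hsubst]
    refine (hCb (φ n) (hφ2 n) hnδ (f - h) (hf.sub hh.measurable)).trans ?_
    gcongr
    exact hfh
  have b3 : ∫⁻ x in K, q x (f x - h x) ≤ η :=
    (lintegral_mono_set (self_subset_cthickening K)).trans hfh
  -- Split `ψ * f - f = (ψ * f - ψ * h) + (ψ * h - h) + (h - f)`.
  calc ∫⁻ x in K, q x ((ψ ⋆[L, volume] f) x - f x)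
      ≤ ∫⁻ x in K, (2 * q x ((ψ ⋆[L, volume] f) x - (ψ ⋆[L, volume] h) x) +
          (4 * q x ((ψ ⋆[L, volume] h) x - h x) + 4 * q x (f x - h x))) := by
        refine lintegral_mono fun x => ?_
        have h1 := hq.add_le x ((ψ ⋆[L, volume] f) x - (ψ ⋆[L, volume] h) x)
          (((ψ ⋆[L, volume] h) x - h x) + (h x - f x))
        have h2 := hq.add_le x ((ψ ⋆[L, volume] h) x - h x) (h x - f x)
        rw [sub_add_sub_cancel, sub_add_sub_cancel, ← sub_add_sub_cancel _ (h x) (f x)] at h1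
        rw [hq.sub_comm x (h x)] at h2
        rw [sub_add_sub_cancel] at h1 h2
        refine h1.trans ?_
        rw [mul_add]
        gcongr
        calc _ ≤ 2 * (2 * (q x ((ψ ⋆[L, volume] h) x - h x) + q x (f x - h x))) := by gcongr
          _ = _ := by ring
    _ = 2 * (∫⁻ x in K, q x ((ψ ⋆[L, volume] f) x - (ψ ⋆[L, volume] h) x)) +
          (4 * (∫⁻ x in K, q x ((ψ ⋆[L, volume] h) x - h x)) + 4 * ∫⁻ x in K, q x (f x - h x)) := by
        rw [lintegral_add_left ((hq.measurable_comp_sub mf mh).const_mul _),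
          lintegral_add_left ((hq.measurable_comp_sub mh hh.measurable).const_mul _),
          lintegral_const_mul' _ _ (by norm_num), lintegral_const_mul' _ _ (by norm_num),
          lintegral_const_mul' _ _ (by norm_num)]
    _ ≤ 2 * (C * η) + (4 * η + 4 * η) := by gcongr
    _ = (2 * C + 8) * η := by ring
    _ = ε := ENNReal.mul_div_cancel hC0 hCt

end IsA2Form

end Form

variable {d : ℕ} {Ω : Set (E d)}

/-! ### Positive semidefinite matrices -/

section MatrixAlgebra

variable {A B P Q : Matrix (Fin d) (Fin d) ℝ}

lemma transpose_matrixSqrt (A : Matrix (Fin d) (Fin d) ℝ) :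
    (matrixSqrt A).transpose = matrixSqrt A := by
  have h : IsSelfAdjoint (matrixSqrt A) := cfc_predicate _ _
  rw [isSelfAdjoint_iff, Matrix.star_eq_conjTranspose] at h
  simpa using h

lemma matrixSqrt_mul_self (hA : A.PosSemidef) : matrixSqrt A * matrixSqrt A = A := by
  have hs : IsSelfAdjoint A := hA.isHermitian
  have hc : ContinuousOn Real.sqrt (spectrum ℝ A) := Real.continuous_sqrt.continuousOn
  calc matrixSqrt A * matrixSqrt A = cfc (fun x => √x * √x) A := (cfc_mul _ _ A hc hc).symm
    _ = cfc (fun x => x) A := cfc_congr fun x hx => Real.mul_self_sqrt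
      ((Matrix.posSemidef_iff_isHermitian_and_spectrum_nonneg.1 hA).2 hx)
    _ = A := cfc_id' ℝ A

lemma trace_transpose_mul_self (B : Matrix (Fin d) (Fin d) ℝ) :
    (B.transpose * B).trace = ∑ j, ∑ i, B i j ^ 2 := by
  simp [Matrix.trace, Matrix.mul_apply, sq]

/-- The operator norm is dominated by the Hilbert–Schmidt norm. -/
lemma norm_toEuclideanCLM_sq_le (B : Matrix (Fin d) (Fin d) ℝ) (v : E d) :
    ‖Matrix.toEuclideanCLM (𝕜 := ℝ) B v‖ ^ 2 ≤ (B.transpose * B).trace * ‖v‖ ^ 2 := by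
  rw [EuclideanSpace.real_norm_sq_eq, EuclideanSpace.real_norm_sq_eq, trace_transpose_mul_self,
    Finset.sum_comm, Finset.sum_mul]
  refine Finset.sum_le_sum fun i _ => ?_
  rw [Matrix.ofLp_toEuclideanCLM]
  exact Finset.sum_mul_sq_le_sq_mul_sq Finset.univ (B i) v

/-- The Hilbert–Schmidt norm is dominated by the operator norm, up to the dimension. -/
lemma trace_transpose_mul_self_le (B : Matrix (Fin d) (Fin d) ℝ) :
    (B.transpose * B).trace ≤ d * opNorm B ^ 2 := by
  rw [trace_transpose_mul_self]
  calc ∑ j, ∑ i, B i j ^ 2 ≤ ∑ _j : Fin d, opNorm B ^ 2 := by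
        refine Finset.sum_le_sum fun j _ => ?_
        have h := (Matrix.toEuclideanCLM (n := Fin d) (𝕜 := ℝ) B).le_opNorm
          (EuclideanSpace.single j 1)
        rw [PiLp.norm_single, norm_one, mul_one] at h
        have h2 : ∑ i, B i j ^ 2 =
            ‖Matrix.toEuclideanCLM (𝕜 := ℝ) B (EuclideanSpace.single j 1)‖ ^ 2 := by
          rw [EuclideanSpace.real_norm_sq_eq]
          refine Finset.sum_congr rfl fun i _ => ?_
          rw [Matrix.ofLp_toEuclideanCLM]
          simp
        rw [h2]
        gcongr
        exact h
    _ = _ := by simp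

lemma inner_toEuclideanCLM_eq_norm_sq (hA : A.PosSemidef) (v : E d) :
    inner ℝ (Matrix.toEuclideanCLM (𝕜 := ℝ) A v) v =
      ‖Matrix.toEuclideanCLM (𝕜 := ℝ) (matrixSqrt A) v‖ ^ 2 := by
  rw [← real_inner_self_eq_norm_sq, real_inner_comm, Matrix.inner_toEuclideanCLM,
    Matrix.inner_toEuclideanCLM, Matrix.ofLp_toEuclideanCLM]
  conv_lhs => rw [← matrixSqrt_mul_self hA, ← Matrix.mulVec_mulVec, Matrix.dotProduct_mulVec]
  rw [← Matrix.vecMul_transpose, transpose_matrixSqrt]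

lemma inner_toEuclideanCLM_le_trace (hA : A.PosSemidef) (v : E d) :
    inner ℝ (Matrix.toEuclideanCLM (𝕜 := ℝ) A v) v ≤ A.trace * ‖v‖ ^ 2 := by
  have := norm_toEuclideanCLM_sq_le (matrixSqrt A) v
  rwa [transpose_matrixSqrt A, matrixSqrt_mul_self hA, ← inner_toEuclideanCLM_eq_norm_sq hA] at this

/-- `⟨P v, v⟩ ≤ tr (P Q⁻¹) ⟨Q v, v⟩`: the trace is the squared Hilbert–Schmidt norm of
`P^{1/2} Q^{-1/2}`, and `P^{1/2} v` is the image of `Q^{1/2} v` under this matrix. -/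
lemma inner_toEuclideanCLM_le_trace_mul_inv (hP : P.PosSemidef) (hQ : Q.PosDef) (v : E d) :
    inner ℝ (Matrix.toEuclideanCLM (𝕜 := ℝ) P v) v ≤
      (P * Q⁻¹).trace * inner ℝ (Matrix.toEuclideanCLM (𝕜 := ℝ) Q v) v := by
  rw [inner_toEuclideanCLM_eq_norm_sq hP, inner_toEuclideanCLM_eq_norm_sq hQ.posSemidef]
  have hS := matrixSqrt_mul_self hQ.posSemidef
  have hSs := transpose_matrixSqrt Q
  have hRs := transpose_matrixSqrt P
  have hR := matrixSqrt_mul_self hP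
  set S := matrixSqrt Q
  set R := matrixSqrt P
  have hu : IsUnit S.det := by
    have h := (Matrix.isUnit_iff_isUnit_det _).1 hQ.isUnit
    rw [← hS, Matrix.det_mul] at h
    exact isUnit_of_mul_isUnit_left h
  have h := norm_toEuclideanCLM_sq_le (R * S⁻¹) (Matrix.toEuclideanCLM (𝕜 := ℝ) S v)
  have e : Matrix.toEuclideanCLM (𝕜 := ℝ) (R * S⁻¹) (Matrix.toEuclideanCLM (𝕜 := ℝ) S v) =
      Matrix.toEuclideanCLM (𝕜 := ℝ) R v := by
    conv_rhs => rw [← Matrix.mul_one R, ← Matrix.nonsing_inv_mul _ hu, ← Matrix.mul_assoc, map_mul]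
    rfl
  rw [e] at h
  convert h using 2
  rw [Matrix.transpose_mul, hRs, Matrix.transpose_nonsing_inv, hSs, Matrix.mul_assoc,
    ← Matrix.mul_assoc R, hR, Matrix.trace_mul_comm S⁻¹, Matrix.mul_assoc, ← Matrix.mul_inv_rev, hS]

lemma trace_mul_eq (hA : A.PosSemidef) (hB : B.PosSemidef) :
    (A * B).trace =
      ((matrixSqrt A * matrixSqrt B).transpose * (matrixSqrt A * matrixSqrt B)).trace := by
  rw [Matrix.transpose_mul, transpose_matrixSqrt A, transpose_matrixSqrt B, Matrix.mul_assoc,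
    ← Matrix.mul_assoc (matrixSqrt A), matrixSqrt_mul_self hA, Matrix.trace_mul_comm (matrixSqrt B),
    Matrix.mul_assoc, matrixSqrt_mul_self hB]

lemma trace_mul_nonneg (hA : A.PosSemidef) (hB : B.PosSemidef) : 0 ≤ (A * B).trace := by
  rw [trace_mul_eq hA hB, trace_transpose_mul_self]
  positivity

lemma trace_mul_le (hA : A.PosSemidef) (hB : B.PosSemidef) :
    (A * B).trace ≤ d * opNorm (matrixSqrt A * matrixSqrt B) ^ 2 := by
  rw [trace_mul_eq hA hB]
  exact trace_transpose_mul_self_le _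

end MatrixAlgebra

/-! ### Integrals of matrix-valued functions -/

section MatrixIntegral

lemma measurable_det {α : Type*} [MeasurableSpace α] {U : α → Matrix (Fin d) (Fin d) ℝ}
    (hU : ∀ i j, Measurable fun x => U x i j) : Measurable fun x => (U x).det := by
  simp only [Matrix.det_apply]
  exact Finset.measurable_sum _ fun σ _ =>
    (Finset.measurable_prod _ fun i _ => hU _ _).const_smul _

lemma measurable_inv_apply {α : Type*} [MeasurableSpace α] {U : α → Matrix (Fin d) (Fin d) ℝ}
    (hU : ∀ i j, Measurable fun x => U x i j) (i j : Fin d) :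
    Measurable fun x => (U x)⁻¹ i j := by
  simp only [Matrix.inv_def, Matrix.smul_apply, Matrix.adjugate_apply, smul_eq_mul,
    Ring.inverse_eq_inv']
  refine (measurable_det hU).inv.mul (measurable_det fun k l => ?_)
  by_cases hk : k = j
  · simp [Matrix.updateRow_apply, hk]
  · simpa [Matrix.updateRow_apply, hk] using hU k l

/-- The entrywise integral of a matrix-valued function. -/
noncomputable def matrixIntegral {α : Type*} [MeasurableSpace α] (ν : Measure α)
    (U : α → Matrix (Fin d) (Fin d) ℝ) : Matrix (Fin d) (Fin d) ℝ :=
  Matrix.of fun i j => ∫ x, U x i j ∂ν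

variable {α : Type*} [MeasurableSpace α] {ν : Measure α} {U : α → Matrix (Fin d) (Fin d) ℝ}

lemma integrable_trace_mul (hU : ∀ i j, Integrable (fun x => U x i j) ν)
    (P : Matrix (Fin d) (Fin d) ℝ) : Integrable (fun x => (P * U x).trace) ν := by
  simp only [Matrix.trace, Matrix.diag, Matrix.mul_apply]
  exact integrable_finsetSum _ fun i _ => integrable_finsetSum _ fun j _ =>
    (hU j i).const_mul _

lemma integral_trace_mul (hU : ∀ i j, Integrable (fun x => U x i j) ν)
    (P : Matrix (Fin d) (Fin d) ℝ) :
    ∫ x, (P * U x).trace ∂ν = (P * matrixIntegral ν U).trace := by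
  simp only [Matrix.trace, Matrix.diag, Matrix.mul_apply]
  refine (integral_finsetSum _ fun i _ =>
    integrable_finsetSum _ fun j _ => (hU j i).const_mul (P i j)).trans ?_
  refine Finset.sum_congr rfl fun i _ => ?_
  refine (integral_finsetSum _ fun j _ => (hU j i).const_mul (P i j)).trans ?_
  exact Finset.sum_congr rfl fun j _ => integral_const_mul _ _

lemma lintegral_trace_mul (hU : ∀ i j, Integrable (fun x => U x i j) ν)
    (hpos : ∀ x, (U x).PosSemidef) {P : Matrix (Fin d) (Fin d) ℝ} (hP : P.PosSemidef) :
    ∫⁻ x, ENNReal.ofReal (P * U x).trace ∂ν = ENNReal.ofReal (P * matrixIntegral ν U).trace := by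
  rw [← integral_trace_mul hU, ofReal_integral_eq_lintegral_ofReal (integrable_trace_mul hU P)
    (ae_of_all _ fun x => trace_mul_nonneg hP (hpos x))]

lemma posSemidef_matrixIntegral (hU : ∀ i j, Integrable (fun x => U x i j) ν)
    (hpos : ∀ x, (U x).PosSemidef) : (matrixIntegral ν U).PosSemidef := by
  refine Matrix.PosSemidef.of_dotProduct_mulVec_nonneg ?_ fun v => ?_
  · ext i j
    simp only [matrixIntegral, Matrix.conjTranspose_apply, Matrix.of_apply, star_trivial]
    exact integral_congr_ae (ae_of_all _ fun x => by simpa using (hpos x).isHermitian.apply i j)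
  · have : star v ⬝ᵥ (matrixIntegral ν U).mulVec v = ∫ x, star v ⬝ᵥ (U x).mulVec v ∂ν := by
      simp only [dotProduct, Matrix.mulVec, matrixIntegral, Matrix.of_apply]
      rw [integral_finsetSum _ fun i _ =>
        (integrable_finsetSum _ fun j _ => (hU i j).mul_const _).const_mul _]
      refine Finset.sum_congr rfl fun i _ => ?_
      rw [integral_const_mul, integral_finsetSum _ fun j _ => (hU i j).mul_const _]
      simp only [integral_mul_const]
    rw [this]
    exact integral_nonneg fun x => (hpos x).dotProduct_mulVec_nonneg v

lemma matrixIntegral_eq_smul_matrixAverage {B : Set (E d)} (hB : volume B ≠ 0)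
    (hB' : volume B ≠ ∞) (U : E d → Matrix (Fin d) (Fin d) ℝ) :
    matrixIntegral (volume.restrict B) U = volume.real B • matrixAverage B U := by
  ext i j
  simp only [matrixIntegral, matrixAverage, Matrix.of_apply, Matrix.smul_apply, smul_eq_mul,
    setAverage_eq]
  rw [mul_inv_cancel_left₀]
  exact (ENNReal.toReal_pos hB hB').ne'

end MatrixIntegral

/-! ### Scalar and matrix weights -/

/-- A matrix weight agrees almost everywhere on `Ω` with a measurable field of positive definite
matrices on the whole space. -/
lemma IsMatrixWeight.exists_measurable {W : E d → Matrix (Fin d) (Fin d) ℝ}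
    (hW : IsMatrixWeight Ω W) :
    ∃ W' : E d → Matrix (Fin d) (Fin d) ℝ, (∀ i j, Measurable fun x => W' x i j) ∧
      (∀ x, (W' x).PosDef) ∧ ∀ᵐ x ∂volume.restrict Ω, W x = W' x := by
  classical
  let V : E d → Matrix (Fin d) (Fin d) ℝ := fun x =>
    Matrix.of fun i j => (hW.aemeasurable i j).mk _ x
  have hV : ∀ᵐ x ∂volume.restrict Ω, W x = V x := by
    have : ∀ᵐ x ∂volume.restrict Ω, ∀ i j, W x i j = (hW.aemeasurable i j).mk _ x :=
      ae_all_iff.2 fun i => ae_all_iff.2 fun j => (hW.aemeasurable i j).ae_eq_mk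
    filter_upwards [this] with x hx
    ext i j
    exact hx i j
  have hVp : ∀ᵐ x ∂volume.restrict Ω, (V x).PosDef := by
    filter_upwards [hV, hW.posDef] with x h1 h2
    rwa [← h1]
  obtain ⟨s, hs, hsm, hs0⟩ := exists_measurable_superset_of_null (ae_iff.1 hVp)
  refine ⟨fun x => if x ∈ s then 1 else V x, fun i j => ?_, fun x => ?_, ?_⟩
  · have : (fun x => (if x ∈ s then 1 else V x) i j) =
        fun x => if x ∈ s then (1 : Matrix (Fin d) (Fin d) ℝ) i j else V x i j := by
      ext x; split_ifs <;> rfl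
    rw [this]
    exact Measurable.ite hsm measurable_const (hW.aemeasurable i j).measurable_mk
  · dsimp only
    split_ifs with hx
    · exact Matrix.PosDef.one
    · by_contra h
      exact hx (hs h)
  · have : ∀ᵐ x ∂volume.restrict Ω, x ∉ s := measure_eq_zero_iff_ae_notMem.1 hs0
    filter_upwards [hV, this] with x h1 h2
    simp [h1, h2]

lemma IsScalarWeight.exists_measurable {μ : E d → ℝ} (hμ : IsScalarWeight Ω μ) :
    ∃ μ' : E d → ℝ, Measurable μ' ∧ (∀ x, 0 < μ' x) ∧ ∀ᵐ x ∂volume.restrict Ω, μ x = μ' x := by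
  classical
  let ν := hμ.aemeasurable.mk μ
  have hν : Measurable ν := hμ.aemeasurable.measurable_mk
  refine ⟨fun x => if 0 < ν x then ν x else 1, ?_, fun x => ?_, ?_⟩
  · exact Measurable.ite (measurableSet_lt measurable_const hν) hν measurable_const
  · dsimp only
    split_ifs with h
    · exact h
    · exact one_pos
  · filter_upwards [hμ.pos, hμ.aemeasurable.ae_eq_mk] with x h1 h2
    have : 0 < ν x := by rwa [← show μ x = ν x from h2]
    simp only [this, if_true]
    exact h2

/-- A function with finite integral over small balls has finite integral over compact sets. -/
lemma lintegral_lt_top_of_forall_ball (hΩ : IsOpen Ω) {w : E d → ℝ≥0∞}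
    (hw : ∀ x r, 0 < r → closedBall x r ⊆ Ω → ∫⁻ y in ball x r, w y < ∞) {K : Set (E d)}
    (hK : IsCompact K) (hKΩ : K ⊆ Ω) : ∫⁻ x in K, w x < ∞ := by
  refine hK.induction_on (p := fun s => ∫⁻ x in s, w x < ∞) (by simp)
    (fun s t hst ht => (lintegral_mono_set hst).trans_lt ht)
    (fun s t hs ht => (lintegral_union_le _ _ _).trans_lt (ENNReal.add_lt_top.2 ⟨hs, ht⟩))
    fun x hx => ?_
  obtain ⟨r, hr, hrΩ⟩ := nhds_basis_closedBall.mem_iff.1 (hΩ.mem_nhds (hKΩ hx))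
  exact ⟨ball x r, mem_nhdsWithin_of_mem_nhds (ball_mem_nhds x hr), hw x r hr hrΩ⟩

/-- The squared seminorm field of a scalar weight. -/
noncomputable def scalarForm (μ : E d → ℝ) (x : E d) (v : ℝ) : ℝ≥0∞ := ENNReal.ofReal (μ x * v ^ 2)

/-- The squared seminorm field of a matrix weight. -/
noncomputable def matrixForm (W : E d → Matrix (Fin d) (Fin d) ℝ) (x : E d) (v : E d) : ℝ≥0∞ :=
  ENNReal.ofReal (inner ℝ (Matrix.toEuclideanCLM (n := Fin d) (𝕜 := ℝ) (W x) v) v)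

/-- A scalar weight in the local `A_2` class, replaced by an everywhere positive measurable
representative, defines a form of Muckenhoupt type. -/
theorem ScalarA2Loc.isA2Form (hΩ : IsOpen Ω) {μ μ' : E d → ℝ} (hμ : ScalarA2Loc Ω μ)
    (hm : Measurable μ') (hpos : ∀ x, 0 < μ' x) (hae : ∀ᵐ x ∂volume.restrict Ω, μ x = μ' x) :
    IsA2Form Ω (scalarForm μ') (fun x => ENNReal.ofReal (μ' x))
      (fun x y => ENNReal.ofReal (μ' x) * ENNReal.ofReal (1 / μ' y)) := by
  have hbound (K : Set (E d)) (hK : IsCompact K) (hKΩ : K ⊆ Ω) : ∃ C : ℝ≥0∞, C < ∞ ∧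
      ∀ x r, 0 < r → ball x r ⊆ K → (∫⁻ y in ball x r, ENNReal.ofReal (μ' y)) *
        (∫⁻ y in ball x r, ENNReal.ofReal (1 / μ' y)) ≤ C * volume (ball x r) ^ 2 := by
    obtain ⟨C, hC, hCb⟩ : ∃ C : ℝ≥0∞, C < ∞ ∧ ∀ x r, 0 < r → ball x r ⊆ K →
        (⨍⁻ y in ball x r, ENNReal.ofReal (μ y) ∂volume) *
          (⨍⁻ y in ball x r, ENNReal.ofReal (1 / μ y) ∂volume) ≤ C :=
      ⟨_, hμ.bound K hK hKΩ, fun x r hr hxr =>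
        le_iSup_of_le x (le_iSup_of_le r (le_iSup_of_le hr (le_iSup_of_le hxr le_rfl)))⟩
    refine ⟨C, hC, fun x r hr hxr => ?_⟩
    have hae' := ae_restrict_of_ae_restrict_of_subset (hxr.trans hKΩ) hae
    have e1 : ∫⁻ y in ball x r, ENNReal.ofReal (μ' y) = ∫⁻ y in ball x r, ENNReal.ofReal (μ y) :=
      lintegral_congr_ae (hae'.mono fun y hy => by simp only [hy])
    have e2 : ∫⁻ y in ball x r, ENNReal.ofReal (1 / μ' y) =
        ∫⁻ y in ball x r, ENNReal.ofReal (1 / μ y) :=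
      lintegral_congr_ae (hae'.mono fun y hy => by simp only [hy])
    have hV0 : volume (ball x r) ≠ 0 := (measure_ball_pos _ _ hr).ne'
    have hVt : volume (ball x r) ≠ ∞ := measure_ball_lt_top.ne
    rw [e1, e2, ← measure_mul_setLAverage (fun y => ENNReal.ofReal (μ y)) hVt,
      ← measure_mul_setLAverage (fun y => ENNReal.ofReal (1 / μ y)) hVt]
    calc _ = (⨍⁻ y in ball x r, ENNReal.ofReal (μ y) ∂volume) *
        (⨍⁻ y in ball x r, ENNReal.ofReal (1 / μ y) ∂volume) * volume (ball x r) ^ 2 := by ring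
      _ ≤ _ := by gcongr; exact hCb x r hr hxr
  have hm1 : Measurable fun x => ENNReal.ofReal (μ' x) := hm.ennreal_ofReal
  have hm2 : Measurable fun x => ENNReal.ofReal (1 / μ' x) := by fun_prop
  refine ⟨?_, fun x => ?_, hm1, fun x v => ?_, fun K hK hKΩ => ?_, ?_, fun x y v => ?_,
    fun K hK hKΩ => ?_⟩
  · unfold scalarForm Function.uncurry
    fun_prop
  · refine ⟨√(μ' x) • ContinuousLinearMap.id ℝ ℝ, fun v => ?_⟩
    simp only [scalarForm, smul_apply, ContinuousLinearMap.id_apply,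
      smul_eq_mul]
    rw [← ofReal_norm, ← ENNReal.ofReal_pow (norm_nonneg _), Real.norm_eq_abs, sq_abs, mul_pow,
      Real.sq_sqrt (hpos x).le]
  · rw [scalarForm, ENNReal.ofReal_mul (hpos x).le, ← ofReal_norm,
      ← ENNReal.ofReal_pow (norm_nonneg _), Real.norm_eq_abs, sq_abs]
  · refine lintegral_lt_top_of_forall_ball hΩ (fun x r hr hxr => ?_) hK hKΩ
    obtain ⟨C, hC, hCb⟩ := hbound _ (isCompact_closedBall x r) hxr
    have h := (hCb x r hr ball_subset_closedBall).trans_lt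
      (ENNReal.mul_lt_top hC (ENNReal.pow_lt_top measure_ball_lt_top))
    -- The integral of `1 / μ` is positive, so finiteness of the product gives that of `∫ μ`.
    refine ENNReal.lt_top_of_mul_ne_top_left h.ne ?_
    rw [ne_eq, setLIntegral_eq_zero_iff measurableSet_ball hm2]
    intro h0
    have : volume (ball x r) = 0 := by
      refine measure_mono_null ?_ (ae_iff.1 h0)
      intro y hy
      have : 0 < 1 / μ' y := one_div_pos.2 (hpos y)
      exact fun h => (ENNReal.ofReal_pos.2 this).ne' (h hy)
    exact (measure_ball_pos _ _ hr).ne' this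
  · exact (hm1.comp measurable_fst).mul (hm2.comp measurable_snd)
  · simp only [scalarForm]
    have h0 : 0 ≤ μ' x * (1 / μ' y) := mul_nonneg (hpos x).le (one_div_pos.2 (hpos y)).le
    rw [← ENNReal.ofReal_mul (hpos x).le, ← ENNReal.ofReal_mul h0]
    refine le_of_eq ?_
    congr 1
    have := (hpos y).ne'
    field_simp
  · obtain ⟨C, hC, hCb⟩ := hbound K hK hKΩ
    refine ⟨C, hC, fun x r hr hxr => ?_⟩
    refine le_of_eq_of_le ?_ (hCb x r hr hxr)
    simp only [lintegral_const_mul _ hm2]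
    rw [lintegral_mul_const _ hm1]

/-- A matrix weight in the local `A_2` class, replaced by an everywhere positive definite measurable
representative, defines a form of Muckenhoupt type. -/
theorem MatrixA2Loc.isA2Form (hΩ : IsOpen Ω) {W W' : E d → Matrix (Fin d) (Fin d) ℝ}
    (hW : MatrixA2Loc Ω W) (hm : ∀ i j, Measurable fun x => W' x i j)
    (hpos : ∀ x, (W' x).PosDef) (hae : ∀ᵐ x ∂volume.restrict Ω, W x = W' x) :
    IsA2Form Ω (matrixForm W') (fun x => ENNReal.ofReal (W' x).trace)
      (fun x y => ENNReal.ofReal (W' x * (W' y)⁻¹).trace) := by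
  have hi := measurable_inv_apply hm
  have hpsd (x) : (W' x).PosSemidef := (hpos x).posSemidef
  have hint (x : E d) (r : ℝ) (hr : 0 < r) (hxr : closedBall x r ⊆ Ω) (i j : Fin d) :
      IntegrableOn (fun y => W' y i j) (ball x r) ∧
        IntegrableOn (fun y => (W' y)⁻¹ i j) (ball x r) := by
    have hae' := ae_restrict_of_ae_restrict_of_subset (ball_subset_closedBall.trans hxr) hae
    exact ⟨(hW.integrable x r hr hxr i j).1.congr (hae'.mono fun y hy => by simp only [hy]),
      (hW.integrable x r hr hxr i j).2.congr (hae'.mono fun y hy => by simp only [hy])⟩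
  have htr (P : Matrix (Fin d) (Fin d) ℝ) : P.trace = (1 * P).trace := by rw [Matrix.one_mul]
  refine ⟨?_, fun x => ?_, ?_, fun x v => ?_, fun K hK hKΩ => ?_, ?_, fun x y v => ?_,
    fun K hK hKΩ => ?_⟩
  · unfold matrixForm Function.uncurry
    simp only [real_inner_comm, Matrix.inner_toEuclideanCLM, dotProduct, Matrix.mulVec]
    refine Measurable.ennreal_ofReal (Finset.measurable_sum _ fun i _ => Measurable.mul ?_
      (Finset.measurable_sum _ fun j _ => ((hm i j).comp measurable_fst).mul ?_))
    · fun_prop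
    · fun_prop
  · refine ⟨Matrix.toEuclideanCLM (n := Fin d) (𝕜 := ℝ) (matrixSqrt (W' x)), fun v => ?_⟩
    rw [matrixForm, inner_toEuclideanCLM_eq_norm_sq (hpsd x), ENNReal.ofReal_pow (norm_nonneg _),
      ofReal_norm]
  · simp only [Matrix.trace, Matrix.diag]
    exact Measurable.ennreal_ofReal (Finset.measurable_sum _ fun i _ => hm i i)
  · rw [← ofReal_norm, ← ENNReal.ofReal_pow (norm_nonneg _),
      ← ENNReal.ofReal_mul (hpsd x).trace_nonneg]
    exact ENNReal.ofReal_le_ofReal (inner_toEuclideanCLM_le_trace (hpsd x) v)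
  · refine lintegral_lt_top_of_forall_ball hΩ (fun x r hr hxr => ?_) hK hKΩ
    simp only [htr (W' _)]
    rw [lintegral_trace_mul (fun i j => (hint x r hr hxr i j).1) hpsd Matrix.PosSemidef.one]
    exact ENNReal.ofReal_lt_top
  · simp only [Matrix.trace, Matrix.diag, Matrix.mul_apply, Function.uncurry_def]
    exact Measurable.ennreal_ofReal (Finset.measurable_sum _ fun i _ =>
      Finset.measurable_sum _ fun j _ =>
        ((hm i j).comp measurable_fst).mul ((hi j i).comp measurable_snd))
  · rw [matrixForm, matrixForm,
      ← ENNReal.ofReal_mul (trace_mul_nonneg (hpsd x) (hpos y).inv.posSemidef)]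
    exact ENNReal.ofReal_le_ofReal (inner_toEuclideanCLM_le_trace_mul_inv (hpsd x) (hpos y) v)
  · obtain ⟨C, hC, hCb⟩ : ∃ C : ℝ≥0∞, C < ∞ ∧ ∀ x r, 0 < r → ball x r ⊆ K →
        ENNReal.ofReal (opNorm (matrixSqrt (matrixAverage (ball x r) W) *
          matrixSqrt (matrixAverage (ball x r) fun y => (W y)⁻¹)) ^ 2) ≤ C :=
      ⟨_, hW.bound K hK hKΩ, fun x r hr hxr =>
        le_iSup_of_le x (le_iSup_of_le r (le_iSup_of_le hr (le_iSup_of_le hxr le_rfl)))⟩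
    refine ⟨d * C, ENNReal.mul_lt_top (by finiteness) hC, fun x r hr hxr => ?_⟩
    have hb := hCb x r hr hxr
    have hcl : closedBall x r ⊆ Ω := by
      rw [← closure_ball x hr.ne']
      exact (closure_minimal hxr hK.isClosed).trans hKΩ
    have hae' := ae_restrict_of_ae_restrict_of_subset (hxr.trans hKΩ) hae
    have e1 : matrixAverage (ball x r) W = matrixAverage (ball x r) W' := by
      ext i j
      exact average_congr (hae'.mono fun y hy => by simp only [hy])
    have e2 : matrixAverage (ball x r) (fun y => (W y)⁻¹) =
        matrixAverage (ball x r) fun y => (W' y)⁻¹ := by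
      ext i j
      exact average_congr (hae'.mono fun y hy => by simp only [hy])
    rw [e1, e2] at hb
    have hV0 : volume (ball x r) ≠ 0 := (measure_ball_pos _ _ hr).ne'
    have hVt : volume (ball x r) ≠ ∞ := measure_ball_lt_top.ne
    have hV : 0 < volume.real (ball x r) := ENNReal.toReal_pos hV0 hVt
    have hI1 := matrixIntegral_eq_smul_matrixAverage hV0 hVt W'
    have hI2 := matrixIntegral_eq_smul_matrixAverage hV0 hVt fun y => (W' y)⁻¹
    have hp1 := posSemidef_matrixIntegral (fun i j => (hint x r hr hcl i j).1) hpsd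
    have hp2 := posSemidef_matrixIntegral (fun i j => (hint x r hr hcl i j).2)
      fun y => (hpos y).inv.posSemidef
    have hA {P Q : Matrix (Fin d) (Fin d) ℝ} (h : P = volume.real (ball x r) • Q)
        (hP : P.PosSemidef) : Q.PosSemidef := by
      have : Q = (volume.real (ball x r))⁻¹ • P := by
        rw [h, smul_smul, inv_mul_cancel₀ hV.ne', one_smul]
      rw [this]
      exact hP.smul (inv_nonneg.2 hV.le)
    simp only [lintegral_trace_mul (fun i j => (hint x r hr hcl i j).2)
      (fun y => (hpos y).inv.posSemidef) (hpsd _)]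
    simp only [Matrix.trace_mul_comm (W' _)]
    rw [lintegral_trace_mul (fun i j => (hint x r hr hcl i j).1) hpsd hp2, Matrix.trace_mul_comm]
    have ht := trace_mul_le (hA hI1 hp1) (hA hI2 hp2)
    rw [hI1, hI2, Matrix.smul_mul, Matrix.mul_smul, smul_smul, Matrix.trace_smul, smul_eq_mul,
      ENNReal.ofReal_mul (by positivity), ENNReal.ofReal_mul hV.le, ofReal_measureReal hVt, ← sq,
      mul_comm]
    gcongr
    refine (ENNReal.ofReal_le_ofReal ht).trans ?_
    rw [ENNReal.ofReal_mul (by positivity), ENNReal.ofReal_natCast]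
    gcongr

/-! ### Mollification of weak gradients -/

/-- The gradient of a mollification is the mollification of the weak gradient, at points whose
distance to the complement of `Ω` exceeds the radius of the mollifier. The functions `v` and `G` are
extensions of `u` and `g` from a neighbourhood of the point to the whole space; the translated
mollifier `y ↦ φ (x - y)` serves as the test function. -/
lemma IsWeakGradientOn.hasGradientAt_convolution {u : E d → ℝ} {g : E d → E d}
    (hu : IsWeakGradientOn Ω u g) (hΩ : IsOpen Ω) (φ : ContDiffBump (0 : E d)) {x : E d}
    (hx : closedBall x φ.rOut ⊆ Ω) {v : E d → ℝ} {G : E d → E d} (hv : LocallyIntegrable v)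
    (huv : ∀ᵐ y ∂volume.restrict (closedBall x φ.rOut), v y = u y)
    (hgG : ∀ᵐ y ∂volume.restrict (closedBall x φ.rOut), G y = g y) :
    HasGradientAt (φ.normed volume ⋆[ContinuousLinearMap.lsmul ℝ ℝ, volume] v)
      ((φ.normed volume ⋆[ContinuousLinearMap.lsmul ℝ ℝ, volume] G) x) x := by
  have hcs := φ.hasCompactSupport_normed (μ := (volume : Measure (E d)))
  have hsm : ContDiff ℝ (⊤ : ℕ∞) (φ.normed (volume : Measure (E d))) := φ.contDiff_normed
  have hsupp : tsupport (φ.normed (volume : Measure (E d))) = closedBall 0 φ.rOut :=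
    φ.tsupport_normed_eq
  set ψ := φ.normed (volume : Measure (E d))
  let L : ℝ →L[ℝ] ℝ →L[ℝ] ℝ := ContinuousLinearMap.lsmul ℝ ℝ
  let θ : E d → ℝ := fun y => ψ (x - y)
  have hθ : ContDiff ℝ (⊤ : ℕ∞) θ := hsm.comp (contDiff_const.sub contDiff_id)
  have hθts : tsupport θ ⊆ closedBall x φ.rOut := by
    refine closure_minimal (fun y hy => ?_) isClosed_closedBall
    have : x - y ∈ closedBall (0 : E d) φ.rOut := hsupp ▸ subset_tsupport ψ hy
    rwa [mem_closedBall_zero_iff, ← dist_eq_norm, dist_comm] at this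
  have hθc : HasCompactSupport θ :=
    (isCompact_closedBall x φ.rOut).of_isClosed_subset (isClosed_tsupport θ) hθts
  have hθ0 {y} (hy : y ∉ closedBall x φ.rOut) : θ y = 0 :=
    image_eq_zero_of_notMem_tsupport fun h => hy (hθts h)
  have hgrad (y) : gradient θ y = -gradient ψ (x - y) := by
    have : fderiv ℝ θ y = -fderiv ℝ ψ (x - y) := by
      have h1 := (hsm.differentiable (by simp) (x - y)).hasFDerivAt.comp y
        ((hasFDerivAt_id y).const_sub x)
      rw [show fderiv ℝ θ y = _ from h1.fderiv]
      ext w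
      simp
    simp [gradient, this]
  have hgθ0 {y} (hy : y ∉ closedBall x φ.rOut) : gradient θ y = 0 := by
    have : fderiv ℝ θ y = 0 :=
      image_eq_zero_of_notMem_tsupport fun h => hy (hθts (tsupport_fderiv_subset ℝ h))
    simp [gradient, this]
  have hgc : Continuous (gradient θ) :=
    (InnerProductSpace.toDual ℝ (E d)).symm.continuous.comp (hθ.continuous_fderiv (by simp))
  have hgcs : HasCompactSupport (gradient θ) :=
    HasCompactSupport.of_support_subset_isCompact (isCompact_closedBall x φ.rOut)
      fun y hy => by_contra fun h => hy (hgθ0 h)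
  have hint : Integrable fun y => v y • gradient θ y :=
    hv.integrable_smul_right_of_hasCompactSupport hgc hgcs
  have hJ : ∫ y, v y • gradient θ y = -(ψ ⋆[ContinuousLinearMap.lsmul ℝ ℝ, volume] G) x := by
    calc ∫ y, v y • gradient θ y = ∫ y in closedBall x φ.rOut, v y • gradient θ y :=
          (setIntegral_eq_integral_of_forall_compl_eq_zero fun y hy => by
            rw [hgθ0 hy, smul_zero]).symm
      _ = ∫ y in closedBall x φ.rOut, u y • gradient θ y :=
          integral_congr_ae (huv.mono fun y hy => congrArg (· • gradient θ y) hy)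
      _ = ∫ y in Ω, u y • gradient θ y :=
          (setIntegral_eq_of_subset_of_forall_sdiff_eq_zero hΩ.measurableSet hx fun y hy => by
            rw [hgθ0 hy.2, smul_zero]).symm
      _ = -∫ y in Ω, θ y • g y := hu.integral_eq θ hθ hθc (hθts.trans hx)
      _ = -∫ y in closedBall x φ.rOut, θ y • g y := by
          rw [setIntegral_eq_of_subset_of_forall_sdiff_eq_zero hΩ.measurableSet hx fun y hy => by
            rw [hθ0 hy.2, zero_smul]]
      _ = -∫ y in closedBall x φ.rOut, θ y • G y := by
          rw [integral_congr_ae (hgG.mono fun y hy => congrArg (θ y • ·) hy)]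
      _ = -∫ y, θ y • G y := by
          rw [setIntegral_eq_integral_of_forall_compl_eq_zero fun y hy => by
            rw [hθ0 hy, zero_smul]]
      _ = _ := by rw [convolution_eq_swap]; rfl
  have hD := hcs.hasFDerivAt_convolution_left L (hsm.of_le (by simp)) hv x
  rw [hasGradientAt_iff_hasFDerivAt]
  have hce : ConvolutionExistsAt (fderiv ℝ ψ) v x (L.precompL (E d)) volume :=
    (hcs.fderiv ℝ).convolutionExists_left (L.precompL (E d)) (hsm.continuous_fderiv (by simp)) hv x
  suffices hE : InnerProductSpace.toDual ℝ (E d)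
      ((ψ ⋆[ContinuousLinearMap.lsmul ℝ ℝ, volume] G) x) =
        (fderiv ℝ ψ ⋆[L.precompL (E d), volume] v) x by
    rw [hE]
    exact hD
  ext w
  rw [InnerProductSpace.toDual_apply_apply,
    ← neg_neg ((ψ ⋆[ContinuousLinearMap.lsmul ℝ ℝ, volume] G) x), ← hJ, inner_neg_left,
    real_inner_comm, ← integral_inner hint, convolution_eq_swap,
    ContinuousLinearMap.integral_apply, ← integral_neg]
  · refine integral_congr_ae (ae_of_all _ fun y => ?_)
    simp only [hgrad, smul_neg, inner_neg_right, neg_neg, real_inner_smul_right]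
    rw [real_inner_comm, gradient, InnerProductSpace.toDual_symm_apply]
    simp [L, ContinuousLinearMap.precompL_apply, mul_comm]
  · have := hce.integrable_swap
    exact this

/-! ### Approximation by smooth functions -/

/-- An open set is exhausted by a sequence of compact subsets that eventually contains each of its
compact subsets. -/
lemma exists_compact_exhaustion (hΩ : IsOpen Ω) :
    ∃ K : ℕ → Set (E d), (∀ n, IsCompact (K n)) ∧ (∀ n, K n ⊆ Ω) ∧
      ∀ S, IsCompact S → S ⊆ Ω → ∀ᶠ n in atTop, S ⊆ K n := by
  have : LocallyCompactSpace Ω := hΩ.locallyCompactSpace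
  let κ : CompactExhaustion Ω := default
  refine ⟨fun n => Subtype.val '' κ n, fun n => (κ.isCompact n).image continuous_subtype_val,
    fun n => Subtype.coe_image_subset _ _, fun S hS hSΩ => ?_⟩
  obtain ⟨n, hn⟩ := κ.exists_superset_of_isCompact
    (Topology.IsInducing.subtypeVal.isCompact_preimage' hS (by simpa using hSΩ))
  filter_upwards [eventually_ge_atTop n] with m hm x hx
  exact ⟨⟨x, hSΩ hx⟩, κ.subset hm (hn hx), rfl⟩

/-- A function that is almost everywhere measurable on a measurable set `K` agrees almost everywhere
on `K` with a measurable function vanishing off `K`. -/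
lemma exists_measurable_extension {F : Type*} [Zero F] [MeasurableSpace F] {K : Set (E d)}
    (hK : MeasurableSet K) {f : E d → F} (hf : AEMeasurable f (volume.restrict K)) :
    ∃ f' : E d → F, Measurable f' ∧ (∀ᵐ x ∂volume.restrict K, f' x = f x) ∧
      ∀ x ∉ K, f' x = 0 := by
  refine ⟨K.indicator (hf.mk f), hf.measurable_mk.indicator hK, ?_,
    fun x hx => indicator_of_notMem hx _⟩
  filter_upwards [hf.ae_eq_mk, ae_restrict_mem hK] with x h1 h2
  rw [indicator_of_mem h2, h1]

lemma integrable_of_ae_eq_of_eq_zero {F : Type*} [NormedAddCommGroup F] {K : Set (E d)}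
    {f f' : E d → F} (hf : IntegrableOn f K) (hff' : ∀ᵐ x ∂volume.restrict K, f' x = f x)
    (h0 : ∀ x ∉ K, f' x = 0) : Integrable f' :=
  (integrableOn_iff_integrable_of_support_subset fun x hx => by_contra fun h => hx (h0 x h)).1
    (hf.congr (hff'.mono fun _ hx => hx.symm))

namespace IsA2Form

variable {F : Type*} [NormedAddCommGroup F] [NormedSpace ℝ F] [MeasurableSpace F]
  {q : E d → F → ℝ≥0∞} {w : E d → ℝ≥0∞} {M : E d → E d → ℝ≥0∞}

lemma lintegral_lt_top_of_ae_eq_of_eq_zero (hq : IsA2Form Ω q w M) {K : Set (E d)}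
    {f f' : E d → F} (hf : ∫⁻ x in K, q x (f x) < ∞)
    (hff' : ∀ᵐ x ∂volume.restrict K, f' x = f x) (h0 : ∀ x ∉ K, f' x = 0) (S : Set (E d)) :
    ∫⁻ x in S, q x (f' x) < ∞ := by
  refine (setLIntegral_le_lintegral S _).trans_lt ?_
  rw [← setLIntegral_eq_of_support_subset (s := K) ?_]
  · rwa [lintegral_congr_ae (g := fun x => q x (f x)) (hff'.mono fun x hx => by simp only [hx])]
  · intro x hx
    by_contra h
    exact hx (by simp [h0 x h, hq.apply_zero])

lemma lintegral_lt_top_of_continuous (hq : IsA2Form Ω q w M) {K : Set (E d)}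
    (hK : IsCompact K) (hKΩ : K ⊆ Ω) {f : E d → F} (hf : Continuous f) :
    ∫⁻ x in K, q x (f x) < ∞ := by
  obtain ⟨C, hC⟩ := hK.exists_bound_of_continuousOn hf.continuousOn
  calc ∫⁻ x in K, q x (f x) ≤ ∫⁻ x in K, w x * ENNReal.ofReal C ^ 2 := by
        refine setLIntegral_mono' hK.measurableSet fun x hx => (hq.le_dom x _).trans ?_
        gcongr
        rw [← ofReal_norm]
        exact ENNReal.ofReal_le_ofReal (hC x hx)
    _ = (∫⁻ x in K, w x) * ENNReal.ofReal C ^ 2 := lintegral_mul_const _ hq.measurable_dom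
    _ < ∞ := ENNReal.mul_lt_top (hq.lintegral_dom K hK hKΩ) (by finiteness)

end IsA2Form

lemma continuous_gradient {v : E d → ℝ} (hv : ContDiff ℝ (⊤ : ℕ∞) v) : Continuous (gradient v) :=
  (InnerProductSpace.toDual ℝ (E d)).symm.continuous.comp (hv.continuous_fderiv (by simp))

lemma scalarSqNorm_congr {S : Set (E d)} {μ μ' u u' : E d → ℝ}
    (h : ∀ᵐ x ∂volume.restrict S, μ x = μ' x) (hu : ∀ᵐ x ∂volume.restrict S, u x = u' x) :
    scalarSqNorm S μ u = ∫⁻ x in S, scalarForm μ' x (u' x) :=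
  lintegral_congr_ae (by filter_upwards [h, hu] with x h1 h2; simp only [scalarForm, h1, h2])

lemma vectorSqNorm_congr {S : Set (E d)} {W W' : E d → Matrix (Fin d) (Fin d) ℝ}
    {v v' : E d → E d} (h : ∀ᵐ x ∂volume.restrict S, W x = W' x)
    (hv : ∀ᵐ x ∂volume.restrict S, v x = v' x) :
    vectorSqNorm S W v = ∫⁻ x in S, matrixForm W' x (v' x) :=
  lintegral_congr_ae (by filter_upwards [h, hv] with x h1 h2; simp only [matrixForm, h1, h2])

/-- Mollifiers whose radii tend to zero and whose inner and outer radii are comparable. -/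
noncomputable def mollifier (d n : ℕ) : ContDiffBump (0 : E d) where
  rIn := 1 / (n + 1) / 2
  rOut := 1 / (n + 1)
  rIn_pos := by positivity
  rIn_lt_rOut := half_lt_self (by positivity)

/-- Approximation on a single compact set: the approximants are mollifications of the restriction
of `u` to a compact neighbourhood. -/
lemma exists_smooth_approximation (hΩ : IsOpen Ω) {μ : E d → ℝ} (hμ : ScalarA2Loc Ω μ)
    {W : E d → Matrix (Fin d) (Fin d) ℝ} (hW : MatrixA2Loc Ω W) {u : E d → ℝ} {g : E d → E d}
    (hu : MemSobolevLoc Ω μ W u g) {K : Set (E d)} (hK : IsCompact K) (hKΩ : K ⊆ Ω)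
    {ε : ℝ≥0∞} (hε : 0 < ε) :
    ∃ v : E d → ℝ, ContDiff ℝ (⊤ : ℕ∞) v ∧ HasCompactSupport v ∧
      scalarSqNorm K μ (v - u) ≤ ε ∧ vectorSqNorm K W (gradient v - g) ≤ ε := by
  obtain ⟨μ', hμm, hμpos, hμae⟩ := hμ.isWeight.exists_measurable
  obtain ⟨W', hWm, hWpos, hWae⟩ := hW.isWeight.exists_measurable
  have hq := hμ.isA2Form hΩ hμm hμpos hμae
  have hQ := hW.isA2Form hΩ hWm hWpos hWae
  obtain ⟨δ, hδ, hsub⟩ := hK.exists_cthickening_subset_open hΩ hKΩ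
  have hK' : IsCompact (cthickening δ K) := hK.cthickening
  have hKK' : K ⊆ cthickening δ K := self_subset_cthickening K
  set K' := cthickening δ K with hK'def
  obtain ⟨hum, hufin⟩ := hu.memL2Loc K' hK' hsub
  obtain ⟨hgm, hgfin⟩ := hu.grad_memL2Loc K' hK' hsub
  obtain ⟨u', hu'm, hu'ae, hu'0⟩ := exists_measurable_extension hK'.measurableSet hum
  obtain ⟨g', hg'm, hg'ae, hg'0⟩ := exists_measurable_extension hK'.measurableSet hgm
  have hu'i : Integrable u' := integrable_of_ae_eq_of_eq_zero
    (hu.isWeakGradient.locallyIntegrable.integrableOn_compact_subset hsub hK') hu'ae hu'0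
  have hg'i : Integrable g' := integrable_of_ae_eq_of_eq_zero
    (hu.isWeakGradient.locallyIntegrable_grad.integrableOn_compact_subset hsub hK') hg'ae hg'0
  have hμK' := ae_restrict_of_ae_restrict_of_subset hsub hμae
  have hWK' := ae_restrict_of_ae_restrict_of_subset hsub hWae
  rw [scalarSqNorm_congr hμK' (ae_of_all _ fun _ => rfl)] at hufin
  rw [vectorSqNorm_congr hWK' (ae_of_all _ fun _ => rfl)] at hgfin
  have hr2 (n : ℕ) : (mollifier d n).rOut ≤ 2 * (mollifier d n).rIn := by
    simp only [mollifier]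
    linarith
  have hr0 : Tendsto (fun n => (mollifier d n).rOut) atTop (𝓝 0) :=
    tendsto_one_div_add_atTop_nhds_zero_nat
  have h1 := hq.tendsto_lintegral_convolution_sub hΩ hK hKΩ hu'm hu'i.locallyIntegrable
    (fun S _ _ => hq.lintegral_lt_top_of_ae_eq_of_eq_zero hufin hu'ae hu'0 S)
    hr2 hr0
  have h2 := hQ.tendsto_lintegral_convolution_sub hΩ hK hKΩ hg'm hg'i.locallyIntegrable
    (fun S _ _ => hQ.lintegral_lt_top_of_ae_eq_of_eq_zero hgfin hg'ae hg'0 S)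
    hr2 hr0
  obtain ⟨n, hn1, hn2, hnδ⟩ := ((ENNReal.tendsto_nhds_zero.1 h1 ε hε).and
    ((ENNReal.tendsto_nhds_zero.1 h2 ε hε).and (hr0.eventually_le_const hδ))).exists
  have hcs := (mollifier d n).hasCompactSupport_normed (μ := (volume : Measure (E d)))
  have hu'c : HasCompactSupport u' :=
    HasCompactSupport.of_support_subset_isCompact hK' fun x hx => by_contra fun h => hx (hu'0 x h)
  refine ⟨(mollifier d n).normed volume ⋆[ContinuousLinearMap.lsmul ℝ ℝ, volume] u',
    hcs.contDiff_convolution_left _ (mollifier d n).contDiff_normed hu'i.locallyIntegrable,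
    hcs.convolution _ hu'c, ?_, ?_⟩
  · refine le_of_eq_of_le (scalarSqNorm_congr
      (ae_restrict_of_ae_restrict_of_subset hKK' hμK') ?_) hn1
    filter_upwards [ae_restrict_of_ae_restrict_of_subset hKK' hu'ae] with x hx
    rw [Pi.sub_apply, hx]
  · refine le_of_eq_of_le (vectorSqNorm_congr
      (ae_restrict_of_ae_restrict_of_subset hKK' hWK') ?_) hn2
    filter_upwards [ae_restrict_of_ae_restrict_of_subset hKK' hg'ae,
      ae_restrict_mem hK.measurableSet] with x hx hxK
    have hb : closedBall x (mollifier d n).rOut ⊆ K' := fun y hy =>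
      mem_cthickening_of_dist_le y x δ K hxK ((mem_closedBall.1 hy).trans hnδ)
    rw [Pi.sub_apply, ← hx, (hu.isWeakGradient.hasGradientAt_convolution hΩ (mollifier d n)
      (hb.trans hsub) hu'i.locallyIntegrable (ae_restrict_of_ae_restrict_of_subset hb hu'ae)
      (ae_restrict_of_ae_restrict_of_subset hb hg'ae)).gradient]

end WeightedSobolev

theorem mainTheorem8 {d : ℕ} (Ω : Set (WeightedSobolev.E d)) (hΩ : IsOpen Ω)
    (μ : WeightedSobolev.E d → ℝ) (hμ : WeightedSobolev.ScalarA2Loc Ω μ)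
    (W : WeightedSobolev.E d → Matrix (Fin d) (Fin d) ℝ) (hW : WeightedSobolev.MatrixA2Loc Ω W)
    (u : WeightedSobolev.E d → ℝ) (g : WeightedSobolev.E d → WeightedSobolev.E d)
    (hu : WeightedSobolev.MemSobolevLoc Ω μ W u g) :
    ∃ un : ℕ → WeightedSobolev.E d → ℝ,
      (∀ n, ContDiff ℝ (⊤ : ℕ∞) (un n) ∧ HasCompactSupport (un n)) ∧
      WeightedSobolev.TendstoScalarL2Loc Ω μ un u ∧
      ∀ ω : Set (WeightedSobolev.E d), IsCompact (closure ω) → closure ω ⊆ Ω →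
        WeightedSobolev.TendstoVectorL2 ω W (fun n => gradient (un n)) g := by
  obtain ⟨μ', hμm, hμpos, hμae⟩ := hμ.isWeight.exists_measurable
  obtain ⟨W', hWm, hWpos, hWae⟩ := hW.isWeight.exists_measurable
  have hq := hμ.isA2Form hΩ hμm hμpos hμae
  have hQ := hW.isA2Form hΩ hWm hWpos hWae
  obtain ⟨K, hK, hKΩ, hKS⟩ := WeightedSobolev.exists_compact_exhaustion hΩ
  have hε (n : ℕ) : (0 : ℝ≥0∞) < (n : ℝ≥0∞)⁻¹ := ENNReal.inv_pos.2 (ENNReal.natCast_ne_top n)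
  choose un hsm hcs h1 h2 using fun n : ℕ =>
    WeightedSobolev.exists_smooth_approximation hΩ hμ hW hu (hK n) (hKΩ n) (hε n)
  refine ⟨un, fun n => ⟨hsm n, hcs n⟩, fun S hS hSΩ => ⟨fun n => ⟨?_, ?_⟩,
    hu.memL2Loc S hS hSΩ, ?_⟩, fun ω hω hωΩ => ⟨fun n => ⟨?_, ?_⟩, ?_, ?_⟩⟩
  · exact (hsm n).continuous.measurable.aemeasurable
  · rw [WeightedSobolev.scalarSqNorm_congr (ae_restrict_of_ae_restrict_of_subset hSΩ hμae)
      (ae_of_all _ fun _ => rfl)]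
    exact hq.lintegral_lt_top_of_continuous hS hSΩ (hsm n).continuous
  · refine tendsto_of_tendsto_of_tendsto_of_le_of_le' tendsto_const_nhds
      ENNReal.tendsto_inv_nat_nhds_zero (Eventually.of_forall fun _ => zero_le) ?_
    filter_upwards [hKS S hS hSΩ] with n hn
    exact (lintegral_mono_set hn).trans (h1 n)
  · exact (WeightedSobolev.continuous_gradient (hsm n)).measurable.aemeasurable
  · refine lt_of_le_of_lt (lintegral_mono_set subset_closure) (?_ :
      WeightedSobolev.vectorSqNorm (closure ω) W (gradient (un n)) < ∞)
    rw [WeightedSobolev.vectorSqNorm_congr (ae_restrict_of_ae_restrict_of_subset hωΩ hWae)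
      (ae_of_all _ fun _ => rfl)]
    exact hQ.lintegral_lt_top_of_continuous hω hωΩ (WeightedSobolev.continuous_gradient (hsm n))
  · obtain ⟨ha, hb⟩ := hu.grad_memL2Loc _ hω hωΩ
    exact ⟨ha.mono_set subset_closure, (lintegral_mono_set subset_closure).trans_lt hb⟩
  · refine tendsto_of_tendsto_of_tendsto_of_le_of_le' tendsto_const_nhds
      ENNReal.tendsto_inv_nat_nhds_zero (Eventually.of_forall fun _ => zero_le) ?_
    filter_upwards [hKS _ hω hωΩ] with n hn
    exact (lintegral_mono_set (subset_closure.trans hn)).trans (h2 n)
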